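/- Let $\tau\in\mathbb C$ with $\operatorname{Im}\tau>0$, let $q=e^{2\pi i\tau}$, and set $$\theta_\tau(\xi)=\sum_{n\in\mathbb Z}(-1)^nq^{\frac12(n+\frac12)^2}e^{(n+\frac12)2\pi i\xi},\qquad F_\tau(\xi,\alpha)=\frac{\theta_\tau'(0)\,\theta_\tau(\xi+\alpha)}{\theta_\tau(\xi)\,\theta_\tau(\alpha)}.$$ For $\xi=s+r\tau\notin\mathbb Z+\mathbb Z\tau$ ($r,s\in\mathbb R$) define $f^{(k)}(\xi)$, $k\ge 0$, by the Laurent expansion at $\alpha=0$ $$e^{2\pi i r\alpha}F_\tau(\xi,\alpha)=\sum_{k\ge0}f^{(k)}(\xi)\,\alpha^{k-1}.$$ Let $x,y$ be non-commuting variables. For $0<t<\frac12$ consider the series $$(-2\pi it)^{\mathrm{ad}(x)(y)}\Bigl(\sum_{r\ge0}\ \sum_{n_1,\dots,n_r\ge0}\ \int_{t<t_1<\dots<t_r<1-t}f^{(n_1)}(t_1)\cdots f^{(n_r)}(t_r)\,dt_1\cdots dt_r\;\mathrm{ad}^{n_1}(x)(y)\cdots\mathrm{ad}^{n_r}(x)(y)\Bigr)(-2\pi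 it)^{-\mathrm{ad}(x)(y)},$$ where $(-2\pi it)^a=\exp(a\log(-2\pi it))$ with the principal branch of the logarithm. The A-elliptic multiple zeta value $I^A(n_1,\dots,n_r;\tau)$ is the limit for $t\to0^+$ of the coefficient of $\mathrm{ad}^{n_1}(x)(y)\cdots\mathrm{ad}^{n_r}(x)(y)$ in this series (the elements $\mathrm{ad}^n(x)(y)$, $n\ge0$, being free generators of the algebra that they generate); write $I^A(n)$ for $I^A(n;\tau)$. The limits defining $I^A(m)$ and $I^A(m,n;\tau)$ exist for all integers $m,n\ge0$, and for all integers $m,n\geq 0$ the following relations hold. (i) (Reflection relation) $I^A(m,n;\tau)=(-1)^{m+n}I^A(n,m;\tau)$. (ii) (Shuffle relation) $I^A(m,n;\tau)+I^A(n,m;\tau)=I^A(m)\,I^A(n)$. (iii) (Fay relation) $$I^A(m,n;\tau)=3\,\delta_{m,1}\delta_{n,1}\zeta(2)-(-1)^nI^A(0,m+n;\tau)+\sum_{r=0}^n(-1)^{n-r}\binom{m-1+r}{r}I^A(m+r,n-r;\tau)+\sum_{r=0}^m(-1)^{n+r}\binom{n-1+r}{r}I^A(n+r,m-r;\tau),$$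 where $\binom{-1+r}{r}$ is $1$ for $r=0$ and $0$ for $r\ge1$. -/

import Mathlib

open Filter Topology

namespace EllipticMZV

/-! ### The Kronecker series and the functions `f^(k)` -/

/-- The odd Jacobi theta function
`θ_τ(ξ) = ∑_{n ∈ ℤ} (-1)^n q^{(n + 1/2)^2 / 2} e^{(n + 1/2) 2πiξ}`, with `q = e^{2πiτ}`. -/
noncomputable def theta (τ ξ : ℂ) : ℂ :=
  ∑' n : ℤ, (-1 : ℂ) ^ n *
    Complex.exp (2 * Real.pi * Complex.I * τ * ((1 / 2) * ((n : ℂ) + 1 / 2) ^ 2)) *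
    Complex.exp (((n : ℂ) + 1 / 2) * (2 * Real.pi * Complex.I * ξ))

/-- The Kronecker series `F_τ(ξ, α) = θ_τ'(0) θ_τ(ξ + α) / (θ_τ(ξ) θ_τ(α))`. -/
noncomputable def kronecker (τ ξ α : ℂ) : ℂ :=
  deriv (theta τ) 0 * theta τ (ξ + α) / (theta τ ξ * theta τ α)

/-- The coefficient `e^{2πi r α} F_τ(ξ, α)` of `dξ` in `Ω_τ(ξ, α)`, where `ξ = s + r τ` with
`r`, `s` real, i.e. `r = Im ξ / Im τ`. -/
noncomputable def Omega (τ ξ α : ℂ) : ℂ :=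
  Complex.exp (2 * Real.pi * Complex.I * ((ξ.im / τ.im : ℝ) : ℂ) * α) * kronecker τ ξ α

/-- The function `α ↦ α Ω_τ(ξ, α)`, extended to its removable singularity `α = 0` by its limit. -/
noncomputable def alphaOmega (τ ξ : ℂ) : ℂ → ℂ :=
  Function.update (fun α => α * Omega τ ξ α) 0 (limUnder (𝓝[≠] 0) fun α => α * Omega τ ξ α)

/-- The function `f^(k)`, where `ω^(k) = f^(k)(ξ) dξ` and `Ω_τ(ξ, α) = ∑_{k ≥ 0} ω^(k) α^{k-1}`:
the `k`-th Taylor coefficient at `α = 0` of `α Ω_τ(ξ, α)`. -/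
noncomputable def f (τ : ℂ) (k : ℕ) (ξ : ℂ) : ℂ :=
  iteratedDeriv k (alphaOmega τ ξ) 0 / (k.factorial : ℂ)

/-! ### Generating series in the elements `ad^n(x)(y)` -/

/-- The element `ad^n(x)(y)` of the free associative algebra on `x = ι 0` and `y = ι 1`. -/
noncomputable def adPow : ℕ → FreeAlgebra ℂ (Fin 2)
  | 0 => FreeAlgebra.ι ℂ 1
  | n + 1 => FreeAlgebra.ι ℂ 0 * adPow n - adPow n * FreeAlgebra.ι ℂ 0

/-- The algebra homomorphism `a ↦ [[a, D a], [0, a]]`, where `D` is the derivation of the free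
algebra on letters `t_0, t_1, …` with `D t_n = t_{n+1}`. -/
noncomputable def shiftHom :
    FreeAlgebra ℂ ℕ →ₐ[ℂ] Matrix (Fin 2) (Fin 2) (FreeAlgebra ℂ ℕ) :=
  FreeAlgebra.lift ℂ fun n =>
    !![FreeAlgebra.ι ℂ n, FreeAlgebra.ι ℂ (n + 1); 0, FreeAlgebra.ι ℂ n]

theorem shiftHom_entries (a : FreeAlgebra ℂ ℕ) :
    shiftHom a 0 0 = a ∧ shiftHom a 1 0 = 0 ∧ shiftHom a 1 1 = a := by
  induction a using FreeAlgebra.induction with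
  | grade0 r => simp [Matrix.algebraMap_matrix_apply]
  | grade1 n => simp [shiftHom]
  | mul a b ha hb => simp [Matrix.mul_apply, ha, hb]
  | add a b ha hb => simp [ha, hb]

/-- The elements `ad^n(x)(y)`, `n ≥ 0`, are free generators of the algebra that they generate.
Hence a series in the products `ad^{n_1}(x)(y) ⋯ ad^{n_r}(x)(y)` has well-defined coefficients, and
such series are formal series in words `n_1 ⋯ n_r` in letters from `ℕ`. -/
theorem adPow_free : Function.Injective (FreeAlgebra.lift ℂ adPow) := by
  let D : Module.End ℂ (FreeAlgebra ℂ ℕ) :=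
    { toFun := fun a => shiftHom a 0 1
      map_add' := by intro a b; simp
      map_smul' := by intro r a; simp }
  have hD : ∀ a b, D (a * b) = a * D b + D a * b := by
    intro a b
    have h1 := shiftHom_entries a
    have h2 := shiftHom_entries b
    simp [D, Matrix.mul_apply, h1, h2]
  have hDι : ∀ n, D (FreeAlgebra.ι ℂ n) = FreeAlgebra.ι ℂ (n + 1) := by
    intro n; simp [D, shiftHom]
  let ψ : FreeAlgebra ℂ (Fin 2) →ₐ[ℂ] Module.End ℂ (FreeAlgebra ℂ ℕ) :=
    FreeAlgebra.lift ℂ ![D, Algebra.lmul ℂ _ (FreeAlgebra.ι ℂ 0)]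
  have hψ : ∀ n, ψ (adPow n) = Algebra.lmul ℂ _ (FreeAlgebra.ι ℂ n) := by
    intro n
    induction n with
    | zero => simp [adPow, ψ]
    | succ n ih =>
      ext v
      have h0 : ψ (FreeAlgebra.ι ℂ 0) = D := by simp [ψ]
      simp [adPow, ih, h0, hD, hDι]
  have hcomp : ψ.comp (FreeAlgebra.lift ℂ adPow) = Algebra.lmul ℂ (FreeAlgebra ℂ ℕ) := by
    ext n : 2
    simp [hψ]
  have key : ∀ p, ψ (FreeAlgebra.lift ℂ adPow p) 1 = p := by
    intro p
    have h := DFunLike.congr_fun hcomp p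
    simp only [AlgHom.comp_apply] at h
    rw [h]; simp
  intro p p' h
  rw [← key p, ← key p', h]

/-- Formal series `∑_w c_w w` with complex coefficients over the words `w = [n_1, …, n_r]`, where
the word `[n_1, …, n_r]` stands for the product `ad^{n_1}(x)(y) ⋯ ad^{n_r}(x)(y)`. -/
abbrev WordSeries : Type := List ℕ → ℂ

/-- The product of two series that extends the concatenation of words. -/
noncomputable def WordSeries.mul (a b : WordSeries) : WordSeries := fun w =>
  ∑ i ∈ Finset.range (w.length + 1), a (w.take i) * b (w.drop i)

/-- The series `exp(c ad(x)(y)) = ∑_{k ≥ 0} c^k / k! (ad(x)(y))^k`. -/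
noncomputable def expAd (c : ℂ) : WordSeries := fun w =>
  if w = List.replicate w.length 1 then c ^ w.length / (w.length.factorial : ℂ) else 0

/-! ### Iterated integrals and elliptic multiple zeta values -/

/-- The iterated integral `∫_{a < t_1 < ⋯ < t_r < b} f^(n_1)(t_1) ⋯ f^(n_r)(t_r) dt_1 ⋯ dt_r` of
`ω^(n_1) ⋯ ω^(n_r)` along the straight path from `a` to `b`, as a repeated integral: `t_1` runs
over `[a, b]` and `(t_2, …, t_r)` over the simplex `t_1 < t_2 < ⋯ < t_r < b`. -/
noncomputable def iterInt (τ : ℂ) : List ℕ → ℝ → ℝ → ℂ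
  | [], _, _ => 1
  | n :: w, a, b => ∫ s in a..b, f τ n (s : ℂ) * iterInt τ w s b

/-- The series `exp[∫ ad(x) Ω_τ(ξ, ad(x))(y)] = 1 + ∑_{k ≥ 1} ∫ (∑_n ω^(n) ad^n(x)(y))^k`, integrated
along the straight path from `t` to `1 - t`. -/
noncomputable def pathSeries (τ : ℂ) (t : ℝ) : WordSeries := fun w => iterInt τ w t (1 - t)

/-- The series
`(-2πit)^{ad(x)(y)} exp[∫_t^{1-t} ad(x) Ω_τ(ξ, ad(x))(y)] (-2πit)^{-ad(x)(y)}`,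
with the principal branch of the logarithm in `(-2πit)^a = exp(log(-2πit) a)`. -/
noncomputable def regSeries (τ : ℂ) (t : ℝ) : WordSeries :=
  WordSeries.mul
    (WordSeries.mul (expAd (Complex.log (-2 * Real.pi * Complex.I * t))) (pathSeries τ t))
    (expAd (-Complex.log (-2 * Real.pi * Complex.I * t)))

/-- The A-elliptic multiple zeta value `I^A(n_1, …, n_r; τ)`: the coefficient of
`ad^{n_1}(x)(y) ⋯ ad^{n_r}(x)(y)` in the limit of `regSeries τ t` as `t → 0`, `t > 0`. -/
noncomputable def IA (τ : ℂ) (w : List ℕ) : ℂ :=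
  limUnder (𝓝[>] (0 : ℝ)) fun t => regSeries τ t w

end EllipticMZV

/-! On the real segment the exponential factor of `Omega` is 1, so the `f^(k)` are the Taylor
coefficients in `α` of `α F_τ(ξ, α)`. Parity and periodicity of `θ` give `f^(k)(1 - s) = (-1)^k
f^(k)(s)`. For `k ≠ 1` these functions extend continuously to `[0, 1]`, while `f^(1)` is `π cot(πs)`
plus a continuous function. Weierstrass' three-term identity (`theta_three_term`) gives the Fay
identity for `F_τ`, whose coefficients (`kroneckerCoeff_fay`) express `f^(m)(s) f^(n)(u)` through
products of functions of `s` and `u - s` and of `u` and `u - s`. `IsFaySystem` records exactly these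
facts; afterwards theta functions play no role.

Reflection is the substitution `(s, u) ↦ (1 - u, 1 - s)`, and shuffle is the decomposition of a
square into two triangles; both already hold before the limit.

For the Fay relation the coefficient identity is integrated. Permuting the gaps `s`, `u - s`, `1 -
u` turns each product into one of the form `φ(s) ψ(u)`, but it does not preserve the truncation `ε <
s < u < 1 - ε`. It does preserve the simplex with all three gaps at least `ε`, and there the
relation holds exactly, without a zeta term (`IsFaySystem.gapSimplexInt_fay`). The two truncations
agree in the limit unless `m = n = 1`. In that case the ordinary integral is 0 by parity and
shuffle, whereas the integral over the symmetric simplex tends to `-ζ(2)`, which is computed from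
the addition formula of the cotangent (`IsFaySystem.tendsto_simplexInt_sub`). The discrepancy `ζ(2)`
enters the Fay relation once on the left and twice on the right, hence the constant `3ζ(2)`.

Conjugation by `(-2πit)^{ad(x)(y)}` adds a logarithmic correction in length two. It cancels the
divergence of integrals involving `f^(1)`, and satisfies the Fay relation by itself
(`fayCombination_correction`). -/

namespace EllipticMZV

/-! ### Parity and quasi-periodicity of the theta function. -/

open Complex Real in
/-- The odd theta function in terms of Mathlib's two-variable Jacobi theta function. -/
theorem theta_eq_jacobiTheta₂ (τ ξ : ℂ) :
    theta τ ξ = cexp (π * I * τ / 4 + π * I * ξ) * jacobiTheta₂ (ξ + τ / 2 + 1 / 2) τ := by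
  rw [theta, jacobiTheta₂, ← tsum_mul_left]
  congr 1 with n
  rw [jacobiTheta₂_term]
  have h : (-1 : ℂ) ^ n = cexp (n * (π * I)) := by
    rw [Complex.exp_int_mul, Complex.exp_pi_mul_I]
  rw [h, ← Complex.exp_add, ← Complex.exp_add, ← Complex.exp_add]
  congr 1
  ring

variable {τ : ℂ}

theorem differentiable_theta (hτ : 0 < τ.im) : Differentiable ℂ (theta τ) := by
  have h : theta τ = fun ξ => Complex.exp (Real.pi * Complex.I * τ / 4 + Real.pi * Complex.I * ξ) *
      jacobiTheta₂ (ξ + τ / 2 + 1 / 2) τ := funext (theta_eq_jacobiTheta₂ τ)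
  rw [h]
  intro ξ
  refine DifferentiableAt.mul (by fun_prop) ?_
  exact (differentiableAt_jacobiTheta₂_fst _ hτ).comp ξ (by fun_prop)

theorem theta_neg (τ ξ : ℂ) : theta τ (-ξ) = -theta τ ξ := by
  -- The substitution `n ↦ -1 - n` changes the sign of `n + 1/2` and of `(-1)^n`.
  rw [theta, ← (Equiv.subLeft (-1 : ℤ)).tsum_eq, theta, ← tsum_neg]
  congr 1 with n
  have h : (-1 : ℂ) ^ (-1 - n) = -(-1) ^ n := by
    rw [zpow_sub₀ (by norm_num), zpow_neg_one, div_eq_mul_inv, ← zpow_neg, zpow_neg,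
      ← inv_zpow]
    norm_num
  simp only [Equiv.subLeft_apply, h, neg_mul, neg_inj]
  rw [show ((-1 - n : ℤ) : ℂ) + 1 / 2 = -((n : ℂ) + 1 / 2) by push_cast; ring, neg_sq]
  congr 2
  ring

theorem theta_zero (τ : ℂ) : theta τ 0 = 0 := by
  have h := theta_neg τ 0
  rw [neg_zero] at h
  exact self_eq_neg.mp h

theorem theta_add_one (τ ξ : ℂ) : theta τ (ξ + 1) = -theta τ ξ := by
  rw [theta_eq_jacobiTheta₂, theta_eq_jacobiTheta₂,
    show ξ + 1 + τ / 2 + 1 / 2 = ξ + τ / 2 + 1 / 2 + 1 by ring, jacobiTheta₂_add_left, ← neg_mul]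
  congr 1
  rw [show Real.pi * Complex.I * τ / 4 + Real.pi * Complex.I * (ξ + 1) =
    Real.pi * Complex.I * τ / 4 + Real.pi * Complex.I * ξ + Real.pi * Complex.I by ring,
    Complex.exp_add _ (Real.pi * Complex.I), Complex.exp_pi_mul_I]
  ring

theorem neg_exp_eq (z : ℂ) : -Complex.exp z = Complex.exp (z + Real.pi * Complex.I) := by
  rw [Complex.exp_add, Complex.exp_pi_mul_I, mul_neg_one]

theorem theta_add_self (τ ξ : ℂ) : theta τ (ξ + τ) =
    -Complex.exp (-Real.pi * Complex.I * τ - 2 * Real.pi * Complex.I * ξ) * theta τ ξ := by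
  rw [theta_eq_jacobiTheta₂, theta_eq_jacobiTheta₂,
    show ξ + τ + τ / 2 + 1 / 2 = ξ + τ / 2 + 1 / 2 + τ by ring, jacobiTheta₂_add_left',
    ← mul_assoc, ← mul_assoc]
  congr 1
  rw [← Complex.exp_add, neg_exp_eq, ← Complex.exp_add, Complex.exp_eq_exp_iff_exists_int]
  refine ⟨-1, ?_⟩
  push_cast
  ring

/-! ### The addition formula -/

/-- The even theta function `∑ q^{k^2} e^{4πikx}` of second order. -/
noncomputable def thetaEven (τ x : ℂ) : ℂ := jacobiTheta₂ (2 * x) (2 * τ)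

/-- The even theta function `∑ q^{(k + 1/2)^2} e^{2πi(2k + 1)x}` of second order. -/
noncomputable def thetaOdd (τ x : ℂ) : ℂ :=
  Complex.exp (Real.pi * Complex.I * τ / 2 + 2 * Real.pi * Complex.I * x) *
    jacobiTheta₂ (2 * x + τ) (2 * τ)

theorem two_mul_im_pos (hτ : 0 < τ.im) : 0 < (2 * τ).im := by simpa using hτ

theorem differentiable_thetaEven (hτ : 0 < τ.im) : Differentiable ℂ (thetaEven τ) := fun x =>
  (differentiableAt_jacobiTheta₂_fst (2 * x) (two_mul_im_pos hτ)).comp x (by fun_prop)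

theorem differentiable_thetaOdd (hτ : 0 < τ.im) : Differentiable ℂ (thetaOdd τ) := fun x => by
  unfold thetaOdd
  refine DifferentiableAt.mul (by fun_prop) ?_
  exact DifferentiableAt.comp (f := fun y => 2 * y + τ) x
    (differentiableAt_jacobiTheta₂_fst (2 * x + τ) (two_mul_im_pos hτ)) (by fun_prop)

/-- Splitting of `ℤ × ℤ` according to the parity of `m - n`. -/
def paritySplit : (ℤ × ℤ) ⊕ (ℤ × ℤ) ≃ ℤ × ℤ where
  toFun := Sum.elim (fun p => (p.1 + p.2, p.1 - p.2 - 1)) (fun p => (p.1 + p.2, p.1 - p.2))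
  invFun p := if (p.1 - p.2) % 2 = 0 then .inr ((p.1 + p.2) / 2, (p.1 - p.2) / 2)
    else .inl ((p.1 + p.2 + 1) / 2, (p.1 - p.2 - 1) / 2)
  left_inv := by
    rintro (⟨k, l⟩ | ⟨k, l⟩)
    · have h : (k + l - (k - l - 1)) % 2 ≠ 0 := by omega
      simp only [Sum.elim_inl, h, if_false, Sum.inl.injEq, Prod.mk.injEq]
      omega
    · have h : (k + l - (k - l)) % 2 = 0 := by omega
      simp only [Sum.elim_inr, h, if_true, Sum.inr.injEq, Prod.mk.injEq]
      omega
  right_inv := by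
    rintro ⟨m, n⟩
    dsimp only
    split_ifs with h
    · simp only [Sum.elim_inr, Prod.mk.injEq]
      omega
    · simp only [Sum.elim_inl, Prod.mk.injEq]
      omega

/-- The summand of the odd theta function. -/
noncomputable def thetaTerm (τ : ℂ) (n : ℤ) (ξ : ℂ) : ℂ :=
  Complex.exp (Real.pi * Complex.I * τ / 4 + Real.pi * Complex.I * ξ) *
    jacobiTheta₂_term n (ξ + τ / 2 + 1 / 2) τ

theorem hasSum_thetaTerm (hτ : 0 < τ.im) (ξ : ℂ) :
    HasSum (fun n => thetaTerm τ n ξ) (theta τ ξ) := by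
  rw [theta_eq_jacobiTheta₂]
  exact (hasSum_jacobiTheta₂_term _ hτ).mul_left _

theorem HasSum.prod_mul_of_summable {a b : ℤ → ℂ} {s t : ℂ} (ha : HasSum a s) (hb : HasSum b t) :
    HasSum (fun p : ℤ × ℤ => a p.1 * b p.2) (s * t) :=
  ha.mul hb (summable_mul_of_summable_norm ha.summable.norm hb.summable.norm)

/-- In the double series over `(m, n)`, the new indices are half the sum and half the difference of
`m + 1/2` and `n + 1/2`. One of the two is an integer and the other a half-integer; the parity of `m
- n` decides which, and it also gives the sign `(-1)^(m+n)`. -/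
theorem theta_mul_theta (hτ : 0 < τ.im) (x y : ℂ) :
    theta τ (x + y) * theta τ (x - y) =
      thetaOdd τ x * thetaEven τ y - thetaEven τ x * thetaOdd τ y := by
  have h2 := two_mul_im_pos hτ
  have hA : ∀ z, HasSum (fun k => jacobiTheta₂_term k (2 * z) (2 * τ)) (thetaEven τ z) :=
    fun z => hasSum_jacobiTheta₂_term _ h2
  have hB : ∀ z, HasSum (fun k => Complex.exp (Real.pi * Complex.I * τ / 2 +
      2 * Real.pi * Complex.I * z) * jacobiTheta₂_term k (2 * z + τ) (2 * τ)) (thetaOdd τ z) :=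
    fun z => (hasSum_jacobiTheta₂_term _ h2).mul_left _
  have h1 := HasSum.prod_mul_of_summable (hasSum_thetaTerm hτ (x + y)) (hasSum_thetaTerm hτ (x - y))
  have h3 := (HasSum.prod_mul_of_summable (hA x) (hB y)).neg
  have h4 := HasSum.prod_mul_of_summable (hB x) (hA y)
  have h5 : HasSum ((fun p : ℤ × ℤ => thetaTerm τ p.1 (x + y) * thetaTerm τ p.2 (x - y)) ∘
      paritySplit) (-(thetaEven τ x * thetaOdd τ y) + thetaOdd τ x * thetaEven τ y) := by
    refine HasSum.sum (h3.congr_fun ?_) (h4.congr_fun ?_)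
    · rintro ⟨k, l⟩
      simp only [Function.comp_apply, paritySplit, Equiv.coe_fn_mk, Sum.elim_inl, thetaTerm,
        jacobiTheta₂_term, ← Complex.exp_add, neg_exp_eq]
      rw [Complex.exp_eq_exp_iff_exists_int]
      -- The shifts by `1/2` in the arguments contribute `πi(m + n) = πi(2k - 1)`, and the minus
      -- sign on the other side contributes `πi`.
      refine ⟨k - 1, ?_⟩
      push_cast
      ring
    · rintro ⟨k, l⟩
      simp only [Function.comp_apply, paritySplit, Equiv.coe_fn_mk, Sum.elim_inr, thetaTerm,
        jacobiTheta₂_term, ← Complex.exp_add]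
      rw [Complex.exp_eq_exp_iff_exists_int]
      refine ⟨k, ?_⟩
      push_cast
      ring
  rw [← paritySplit.hasSum_iff] at h1
  rw [h1.unique h5]
  ring

/-- Weierstrass' three-term identity. -/
theorem theta_three_term (hτ : 0 < τ.im) (a b x y : ℂ) :
    theta τ (a + b) * theta τ (x + a) * theta τ (y + b) * theta τ (y - x) =
      theta τ a * theta τ (x + a + b) * theta τ (y - x + b) * theta τ y -
      theta τ b * theta τ (y + a + b) * theta τ (x - y + a) * theta τ x := by
  -- By `theta_mul_theta` each `θ(p + q) θ(p - q)` is a 2×2 determinant of the vectors `(thetaOdd,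
  -- thetaEven)` at `p` and `q`. The identity is the Plücker relation for four vectors in the plane.
  have key : ∀ p q r s : ℂ, theta τ (p + q) * theta τ (p - q) * (theta τ (r + s) * theta τ (r - s)) -
      theta τ (p + r) * theta τ (p - r) * (theta τ (q + s) * theta τ (q - s)) +
      theta τ (p + s) * theta τ (p - s) * (theta τ (q + r) * theta τ (q - r)) = 0 := by
    intro p q r s
    simp only [theta_mul_theta hτ]
    ring
  have h := key ((x + y + a + b) / 2) ((x - y + a - b) / 2) ((a + b + y - x) / 2)
    ((a + b - y + x) / 2)
  have e1 : theta τ (-b) = -theta τ b := theta_neg τ b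
  have e2 : theta τ (-(y - x + b)) = -theta τ (y - x + b) := theta_neg τ _
  rw [show (x + y + a + b) / 2 + (x - y + a - b) / 2 = x + a by ring,
    show (x + y + a + b) / 2 - (x - y + a - b) / 2 = y + b by ring,
    show (a + b + y - x) / 2 + (a + b - y + x) / 2 = a + b by ring,
    show (a + b + y - x) / 2 - (a + b - y + x) / 2 = y - x by ring,
    show (x + y + a + b) / 2 + (a + b + y - x) / 2 = y + a + b by ring,
    show (x + y + a + b) / 2 - (a + b + y - x) / 2 = x by ring,
    show (x - y + a - b) / 2 + (a + b - y + x) / 2 = x - y + a by ring,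
    show (x - y + a - b) / 2 - (a + b - y + x) / 2 = -b by ring,
    show (x + y + a + b) / 2 + (a + b - y + x) / 2 = x + a + b by ring,
    show (x + y + a + b) / 2 - (a + b - y + x) / 2 = y by ring,
    show (x - y + a - b) / 2 + (a + b + y - x) / 2 = a by ring,
    show (x - y + a - b) / 2 - (a + b + y - x) / 2 = -(y - x + b) by ring, e1, e2] at h
  linear_combination h

/-! ### Nonvanishing -/

theorem theta_ne_zero_function (hτ : 0 < τ.im) : ∃ ξ, theta τ ξ ≠ 0 := by
  by_contra! h
  have hj : ∀ z, jacobiTheta₂ z τ = 0 := by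
    intro z
    have h1 := h (z - τ / 2 - 1 / 2)
    rw [theta_eq_jacobiTheta₂, mul_eq_zero] at h1
    have h2 := h1.resolve_left (Complex.exp_ne_zero _)
    rwa [show z - τ / 2 - 1 / 2 + τ / 2 + 1 / 2 = z by ring] at h2
  -- The zeroth Fourier coefficient of the Jacobi theta function on `[0, 1]` is 1, so it cannot
  -- vanish identically.
  let F : ℤ → C(ℝ, ℂ) := fun n => ⟨fun x => jacobiTheta₂_term n x τ, by
    unfold jacobiTheta₂_term; fun_prop⟩
  have hF : HasSum (fun n : ℤ => ∫ x in (0 : ℝ)..1, F n x) (∫ x in (0 : ℝ)..1, ∑' n, F n x) := by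
    refine intervalIntegral.hasSum_intervalIntegral_of_summable_norm ?_
    refine ((summable_jacobiTheta₂_term_iff 0 τ).mpr hτ).norm.of_nonneg_of_le
      (fun _ => norm_nonneg _) fun n => ?_
    rw [ContinuousMap.norm_le _ (norm_nonneg _)]
    intro x
    simp [F, norm_jacobiTheta₂_term]
  have h0 : ∀ x : ℝ, ∑' n, F n x = 0 := fun x => hj x
  have h1 : ∀ n : ℤ, n ≠ 0 → ∫ x in (0 : ℝ)..1, F n x = 0 := by
    intro n hn
    have hc : 2 * Real.pi * Complex.I * n ≠ 0 := by
      simp [hn, Real.pi_ne_zero]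
    simp only [F, ContinuousMap.coe_mk, jacobiTheta₂_term, Complex.exp_add,
      intervalIntegral.integral_mul_const]
    rw [integral_exp_mul_complex hc]
    have : Complex.exp (2 * Real.pi * Complex.I * n) = 1 := by
      rw [Complex.exp_eq_one_iff]; exact ⟨n, by ring⟩
    simp [this]
  have h2 : ∫ x in (0 : ℝ)..1, F 0 x = 1 := by
    simp [F, jacobiTheta₂_term]
  simp only [h0, intervalIntegral.integral_zero] at hF
  have h3 := hF.unique (hasSum_single 0 h1)
  rw [h2] at h3
  exact zero_ne_one h3

/-- Entire functions with vanishing Wronskian are proportional. -/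
theorem exists_eq_const_mul_of_wronskian_eq_zero {f g : ℂ → ℂ} (hf : Differentiable ℂ f)
    (hg : Differentiable ℂ g) (h : ∀ z, deriv f z * g z = f z * deriv g z) {z₀ : ℂ}
    (hz₀ : g z₀ ≠ 0) : ∃ c, ∀ z, f z = c * g z := by
  obtain ⟨r, hr, hball⟩ := Metric.eventually_nhds_iff_ball.mp
    (hg.continuous.continuousAt.eventually_ne hz₀)
  refine ⟨f z₀ / g z₀, fun z => ?_⟩
  have hfa : AnalyticOnNhd ℂ f Set.univ := fun z _ => hf.analyticAt z
  have hga : AnalyticOnNhd ℂ (fun z => f z₀ / g z₀ * g z) Set.univ :=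
    fun z _ => (hg.const_mul _).analyticAt z
  refine congr_fun (hfa.eq_of_eventuallyEq hga (z₀ := z₀) ?_) z
  filter_upwards [Metric.ball_mem_nhds z₀ hr] with w hw
  have h1 : f w / g w = f z₀ / g z₀ := by
    refine Metric.isOpen_ball.is_const_of_deriv_eq_zero (f := fun z => f z / g z)
      (convex_ball z₀ r).isPreconnected
      (fun z hz => ((hf z).div (hg z) (hball z hz)).differentiableWithinAt) ?_ hw
      (Metric.mem_ball_self hr)
    intro z hz
    have := deriv_fun_div (hf z) (hg z) (hball z hz)
    simp only [this, h z, sub_self, zero_div, Pi.zero_apply]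
  rw [← h1, div_mul_cancel₀ _ (hball w hw)]

/-- Differentiating `theta_mul_theta` in `x` at `x = y` gives `θ'(0) θ(2y)` as the Wronskian of
`thetaOdd` and `thetaEven`. If `θ'(0) = 0` the two functions are proportional, and then `θ(ξ)^2`
vanishes for every `ξ`. -/
theorem deriv_theta_zero_ne_zero (hτ : 0 < τ.im) : deriv (theta τ) 0 ≠ 0 := by
  intro h0
  have hθ := differentiable_theta hτ
  have hA := differentiable_thetaEven hτ
  have hB := differentiable_thetaOdd hτ
  obtain ⟨ξ, hξ⟩ := theta_ne_zero_function hτ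
  have hsq : theta τ (ξ + 0) * theta τ (ξ - 0) ≠ 0 := by simpa using hξ
  have hD := theta_mul_theta hτ ξ 0
  have hw : ∀ y, deriv (thetaOdd τ) y * thetaEven τ y = thetaOdd τ y * deriv (thetaEven τ) y := by
    intro y
    have h1 : HasDerivAt (fun x => theta τ (x + y) * theta τ (x - y))
        (deriv (theta τ) (y + y) * theta τ (y - y) + theta τ (y + y) * deriv (theta τ) (y - y)) y :=
      ((hθ (y + y)).hasDerivAt.comp_add_const y y).mul ((hθ (y - y)).hasDerivAt.comp_sub_const y y)
    have h2 : HasDerivAt (fun x => thetaOdd τ x * thetaEven τ y - thetaEven τ x * thetaOdd τ y)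
        (deriv (thetaOdd τ) y * thetaEven τ y - deriv (thetaEven τ) y * thetaOdd τ y) y :=
      ((hB y).hasDerivAt.mul_const _).sub ((hA y).hasDerivAt.mul_const _)
    simp only [theta_mul_theta hτ] at h1
    have h3 := h2.unique h1
    rw [sub_self, h0, theta_zero] at h3
    linear_combination h3
  have hne : ∃ z, thetaEven τ z ≠ 0 := by
    by_contra! h
    rw [hD, h, h] at hsq
    simp at hsq
  obtain ⟨z, hz⟩ := hne
  obtain ⟨c, hc⟩ := exists_eq_const_mul_of_wronskian_eq_zero hB hA hw hz
  rw [hD, hc, hc] at hsq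
  exact hsq (by ring)

/-- A zero of the theta function yields a translation under which it is quasi-periodic. -/
theorem exists_theta_add_eq_of_theta_eq_zero (hτ : 0 < τ.im) {a : ℂ} (ha : theta τ a = 0) :
    ∃ c l : ℂ, ∀ u, theta τ (u + a) = c * Complex.exp (l * u) * theta τ u := by
  have hθ := differentiable_theta hτ
  obtain ⟨y, hy⟩ : ∃ y, theta τ y * theta τ (y - a) ≠ 0 := by
    by_contra! h
    have h1 : AnalyticOnNhd ℂ (theta τ) Set.univ := fun z _ => hθ.analyticAt z
    have h2 : AnalyticOnNhd ℂ (fun y => theta τ (y - a)) Set.univ :=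
      fun z _ => (hθ.comp (differentiable_id.sub_const a)).analyticAt z
    obtain ⟨ξ, hξ⟩ := theta_ne_zero_function hτ
    rcases h1.eq_zero_or_eq_zero_of_mul_eq_zero h2 (fun z _ => h z) isPreconnected_univ with h3 | h3
    · exact hξ (h3 ξ trivial)
    · exact hξ (by simpa using h3 (ξ + a) trivial)
  -- The difference of the logarithmic derivatives of `θ` at `y - a` and at `y`; since `y` is fixed,
  -- it is a constant.
  set l := (deriv (theta τ) (y - a) * theta τ y - theta τ (y - a) * deriv (theta τ) y) /
    (theta τ y * theta τ (y - a)) with hl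
  have hw : ∀ u, deriv (theta τ) (u + a) * theta τ u - theta τ (u + a) * deriv (theta τ) u =
      -l * (theta τ u * theta τ (u + a)) := by
    intro u
    -- With `θ(a) = 0` one term of the three-term identity drops out. The derivative of the
    -- remaining equality at `b = 0` says that `θ'/θ(u + a) - θ'/θ(u)` equals the constant `-l`.
    have h1 : HasDerivAt (fun b => theta τ (u + b) * theta τ (a + u) * theta τ (y + b) *
        theta τ (y - a)) (((deriv (theta τ) (u + 0) * theta τ (a + u)) * theta τ (y + 0) +
        theta τ (u + 0) * theta τ (a + u) * deriv (theta τ) (y + 0)) * theta τ (y - a)) 0 :=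
      ((((hθ (u + 0)).hasDerivAt.comp_const_add u 0).mul_const _).mul
        ((hθ (y + 0)).hasDerivAt.comp_const_add y 0)).mul_const _
    have h2 : HasDerivAt (fun b => theta τ u * theta τ (a + u + b) * theta τ (y - a + b) *
        theta τ y) (((theta τ u * deriv (theta τ) (a + u + 0)) * theta τ (y - a + 0) +
        theta τ u * theta τ (a + u + 0) * deriv (theta τ) (y - a + 0)) * theta τ y) 0 :=
      ((((hθ (a + u + 0)).hasDerivAt.comp_const_add (a + u) 0).const_mul _).mul
        ((hθ (y - a + 0)).hasDerivAt.comp_const_add (y - a) 0)).mul_const _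
    simp only [theta_three_term hτ, ha, mul_zero, sub_zero] at h1
    have h3 := h1.unique h2
    simp only [add_zero] at h3
    rw [add_comm a u] at h3
    apply mul_left_cancel₀ hy
    have h4 := div_mul_cancel₀ (deriv (theta τ) (y - a) * theta τ y -
      theta τ (y - a) * deriv (theta τ) y) hy
    rw [← hl] at h4
    linear_combination -h3 + theta τ u * theta τ (u + a) * h4
  obtain ⟨ξ, hξ⟩ := theta_ne_zero_function hτ
  have hd : ∀ u, HasDerivAt (fun u => theta τ (u + a) * Complex.exp (l * u))
      (deriv (theta τ) (u + a) * Complex.exp (l * u) +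
        theta τ (u + a) * (Complex.exp (l * u) * (l * 1))) u := fun u =>
    ((hθ (u + a)).hasDerivAt.comp_add_const u a).mul ((hasDerivAt_id u).const_mul l).cexp
  obtain ⟨c, hc⟩ := exists_eq_const_mul_of_wronskian_eq_zero (g := theta τ)
    (fun u => (hd u).differentiableAt) hθ (fun u => by
      rw [(hd u).deriv]
      linear_combination Complex.exp (l * u) * hw u) hξ
  refine ⟨c, -l, fun u => ?_⟩
  have h1 : Complex.exp (l * u) * Complex.exp (-l * u) = 1 := by
    rw [← Complex.exp_add]; simp
  linear_combination Complex.exp (-l * u) * hc u - theta τ (u + a) * h1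

/-- A zero `a` gives `θ(u + a) = c e^{lu} θ(u)`. Compatibility with the translations by 1 and by `τ`
forces `a` into `ℤ + ℤτ`, and a real element of that lattice is an integer. -/
theorem theta_ofReal_ne_zero (hτ : 0 < τ.im) {a : ℝ} (ha : a ∈ Set.Ioo (0 : ℝ) 1) :
    theta τ a ≠ 0 := by
  intro h0
  obtain ⟨c, l, h⟩ := exists_theta_add_eq_of_theta_eq_zero hτ h0
  obtain ⟨ξ, hξ⟩ := theta_ne_zero_function hτ
  have hc : c * Complex.exp (l * (ξ - a)) * theta τ (ξ - a) ≠ 0 := by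
    rw [← h]; simpa using hξ
  set u := ξ - a
  have hθ : theta τ u ≠ 0 := right_ne_zero_of_mul hc
  have h1 : Complex.exp l = 1 := by
    have h2 := h (u + 1)
    rw [show u + 1 + a = u + a + 1 by ring, theta_add_one, theta_add_one, h, mul_add,
      Complex.exp_add, mul_one] at h2
    apply mul_left_cancel₀ hc
    linear_combination h2
  have h2 : Complex.exp (l * τ) = Complex.exp (-(2 * Real.pi * Complex.I * a)) := by
    have h2 := h (u + τ)
    rw [show u + τ + a = u + a + τ by ring, theta_add_self, theta_add_self, h, mul_add l,
      Complex.exp_add (l * u), mul_add (2 * Real.pi * Complex.I : ℂ), ← sub_sub,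
      sub_eq_add_neg _ (2 * Real.pi * Complex.I * (a : ℂ)), Complex.exp_add _ (-_)] at h2
    apply mul_left_cancel₀ (mul_ne_zero (Complex.exp_ne_zero
      (-Real.pi * Complex.I * τ - 2 * Real.pi * Complex.I * u)) hc)
    linear_combination h2
  obtain ⟨k, hk⟩ := Complex.exp_eq_one_iff.mp h1
  obtain ⟨n, hn⟩ := Complex.exp_eq_exp_iff_exists_int.mp h2
  have hpi : (2 * Real.pi * Complex.I : ℂ) ≠ 0 := by simp [Real.pi_ne_zero]
  have h3 : (k : ℂ) * τ = -a + n := by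
    apply mul_left_cancel₀ hpi
    rw [hk] at hn
    linear_combination hn
  have h4 := congr_arg Complex.im h3
  have h5 := congr_arg Complex.re h3
  simp only [Complex.mul_im, Complex.intCast_re, Complex.intCast_im, zero_mul, add_zero,
    Complex.add_im, Complex.neg_im, Complex.ofReal_im, neg_zero, mul_eq_zero, hτ.ne',
    or_false, Int.cast_eq_zero] at h4
  simp only [h4, Int.cast_zero, zero_mul, Complex.zero_re, Complex.add_re, Complex.neg_re,
    Complex.ofReal_re, Complex.intCast_re] at h5
  have h6 : (n : ℝ) = a := by linarith
  rw [← h6] at ha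
  have h7 : 0 < n := by exact_mod_cast ha.1
  have h8 : n < 1 := by exact_mod_cast ha.2
  omega

/-! ### Taylor coefficients -/

/-- The `n`-th Taylor coefficient of `g` at `z`. -/
noncomputable def taylorCoeff (n : ℕ) (g : ℂ → ℂ) (z : ℂ) : ℂ :=
  iteratedDeriv n g z / n.factorial

theorem taylorCoeff_zero (g : ℂ → ℂ) (z : ℂ) : taylorCoeff 0 g z = g z := by
  simp [taylorCoeff]

theorem taylorCoeff_congr {g h : ℂ → ℂ} {z : ℂ} (H : g =ᶠ[𝓝 z] h) (n : ℕ) :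
    taylorCoeff n g z = taylorCoeff n h z := by
  rw [taylorCoeff, H.iteratedDeriv_eq, taylorCoeff]

theorem taylorCoeff_mul {g h : ℂ → ℂ} {z : ℂ} (hg : AnalyticAt ℂ g z) (hh : AnalyticAt ℂ h z)
    (n : ℕ) : taylorCoeff n (fun w => g w * h w) z =
      ∑ i ∈ Finset.range (n + 1), taylorCoeff i g z * taylorCoeff (n - i) h z := by
  have h1 : iteratedDeriv n (fun w => g w * h w) z = _ :=
    iteratedDeriv_mul (n := n) hg.contDiffAt hh.contDiffAt
  rw [taylorCoeff, h1, Finset.sum_div]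
  refine Finset.sum_congr rfl fun i hi => ?_
  have hi' : i ≤ n := Nat.lt_succ_iff.mp (Finset.mem_range.mp hi)
  have h2 : (n.factorial : ℂ) = n.choose i * i.factorial * (n - i).factorial := by
    exact_mod_cast (Nat.choose_mul_factorial_mul_factorial hi').symm
  have h3 : (n.choose i : ℂ) ≠ 0 := by exact_mod_cast (Nat.choose_pos hi').ne'
  have h4 : ∀ k : ℕ, (k.factorial : ℂ) ≠ 0 := fun k => by exact_mod_cast k.factorial_ne_zero
  have h5 := h4 i
  have h6 := h4 (n - i)
  rw [taylorCoeff, taylorCoeff, h2]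
  field_simp

theorem taylorCoeff_mul_const (n : ℕ) (g : ℂ → ℂ) (c z : ℂ) :
    taylorCoeff n (fun w => g w * c) z = taylorCoeff n g z * c := by
  rw [taylorCoeff, iteratedDeriv_mul_const_field, taylorCoeff]
  ring

theorem taylorCoeff_const_mul (n : ℕ) (g : ℂ → ℂ) (c z : ℂ) :
    taylorCoeff n (fun w => c * g w) z = c * taylorCoeff n g z := by
  simp_rw [mul_comm c]
  exact taylorCoeff_mul_const n g c z

theorem taylorCoeff_add {g h : ℂ → ℂ} {z : ℂ} (hg : AnalyticAt ℂ g z) (hh : AnalyticAt ℂ h z)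
    (n : ℕ) : taylorCoeff n (fun w => g w + h w) z = taylorCoeff n g z + taylorCoeff n h z := by
  have h1 : iteratedDeriv n (fun w => g w + h w) z = _ :=
    iteratedDeriv_add (n := n) hg.contDiffAt hh.contDiffAt
  rw [taylorCoeff, h1, add_div, taylorCoeff, taylorCoeff]

theorem taylorCoeff_sum {ι : Type*} (s : Finset ι) {g : ι → ℂ → ℂ} {z : ℂ}
    (hg : ∀ i ∈ s, AnalyticAt ℂ (g i) z) (n : ℕ) :
    taylorCoeff n (fun w => ∑ i ∈ s, g i w) z = ∑ i ∈ s, taylorCoeff n (g i) z := by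
  rw [taylorCoeff, iteratedDeriv_fun_sum fun i hi => (hg i hi).contDiffAt, Finset.sum_div]
  rfl

theorem taylorCoeff_id_mul {g : ℂ → ℂ} (hg : AnalyticAt ℂ g 0) (n : ℕ) :
    taylorCoeff (n + 1) (fun w => w * g w) 0 = taylorCoeff n g 0 := by
  rw [taylorCoeff_mul (g := fun w => w) analyticAt_id hg, Finset.sum_eq_single 1]
  · simp [taylorCoeff]
  · intro i _ hi
    have : iteratedDeriv i (fun z : ℂ => z) 0 = 0 := by
      rw [iteratedDeriv_fun_id_zero, if_neg hi]
    simp [taylorCoeff, this]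
  · simp

theorem taylorCoeff_comp_neg (n : ℕ) (g : ℂ → ℂ) :
    taylorCoeff n (fun w => g (-w)) 0 = (-1) ^ n * taylorCoeff n g 0 := by
  rw [taylorCoeff, iteratedDeriv_comp_neg, neg_zero, smul_eq_mul, taylorCoeff, mul_div_assoc]

theorem taylorCoeff_comp_const_add (n : ℕ) (g : ℂ → ℂ) (c z : ℂ) :
    taylorCoeff n (fun w => g (c + w)) z = taylorCoeff n g (c + z) := by
  rw [taylorCoeff, iteratedDeriv_comp_const_add, taylorCoeff]

theorem taylorCoeff_taylorCoeff (i k : ℕ) (g : ℂ → ℂ) (z : ℂ) :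
    taylorCoeff k (taylorCoeff i g) z = (i + 1).multichoose k * taylorCoeff (i + k) g z := by
  have h1 : taylorCoeff i g = fun w => iteratedDeriv i g w * ((i.factorial : ℂ))⁻¹ := by
    ext w; rw [taylorCoeff, div_eq_mul_inv]
  have h2 : iteratedDeriv k (iteratedDeriv i g) = iteratedDeriv (i + k) g := by
    simp only [iteratedDeriv_eq_iterate, ← Function.iterate_add_apply, add_comm]
  rw [h1, taylorCoeff_mul_const, taylorCoeff, h2, taylorCoeff, Nat.multichoose_eq]
  have h3 : ((i + k).factorial : ℂ) = (i + 1 + k - 1).choose k * i.factorial * k.factorial := by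
    rw [show i + 1 + k - 1 = i + k by omega, ← Nat.add_choose_mul_factorial_mul_factorial i k]
    push_cast
    ring
  have h4 : ∀ k : ℕ, (k.factorial : ℂ) ≠ 0 := fun k => by exact_mod_cast k.factorial_ne_zero
  have h5 : ((i + 1 + k - 1).choose k : ℂ) ≠ 0 := by
    exact_mod_cast (Nat.choose_pos (by omega)).ne'
  have h6 := h4 i
  have h7 := h4 k
  rw [h3]
  field_simp

theorem analyticAt_taylorCoeff {g : ℂ → ℂ} {z : ℂ} (hg : AnalyticAt ℂ g z) (n : ℕ) :
    AnalyticAt ℂ (taylorCoeff n g) z := by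
  have h1 : taylorCoeff n g = fun w => deriv^[n] g w / (n.factorial : ℂ) := by
    ext w; rw [taylorCoeff, iteratedDeriv_eq_iterate]
  rw [h1]
  exact (hg.iterated_deriv n).div_const

/-! ### The Fay identity for coefficients -/

/-- Pascal's rule, in the shape needed by the induction step of `fay_of_generating`. -/
theorem sum_multichoose_pascal (X Z : ℕ → ℂ) (m n : ℕ) :
    ∑ r ∈ Finset.range (n + 1), ((m + 1).multichoose r : ℂ) * X (m + 1 + r) * Z (n - r) +
      ∑ r ∈ Finset.range (n + 2), (m.multichoose r : ℂ) * X (m + r) * Z (n + 1 - r) =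
    ∑ r ∈ Finset.range (n + 2), ((m + 1).multichoose r : ℂ) * X (m + r) * Z (n + 1 - r) := by
  rw [Finset.sum_range_succ' _ (n + 1), Finset.sum_range_succ' _ (n + 1), ← add_assoc,
    ← Finset.sum_add_distrib]
  congr 1
  · refine Finset.sum_congr rfl fun r _ => ?_
    rw [Nat.multichoose_succ_succ, Nat.add_sub_add_right, show m + 1 + r = m + (r + 1) by omega]
    push_cast
    ring
  · simp

/-- The Fay identity for products, from its generating form. -/
theorem fay_of_generating (X Y Z W : ℕ → ℂ) (hX : X 0 = 1) (hZ : Z 0 = 1)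
    (hW : ∀ j, W j = (-1) ^ j * Z j)
    (H : ∀ a b, X a * Y (b + 1) + X (a + 1) * Y b =
      ∑ r ∈ Finset.range (b + 2), ((a + 1).multichoose r : ℂ) * X (a + r) * Z (b + 1 - r) +
      ∑ r ∈ Finset.range (a + 2), ((b + 1).multichoose r : ℂ) * Y (b + r) * W (a + 1 - r))
    (m n : ℕ) : X m * Y n = -((-1) ^ m * Z (m + n)) +
      ∑ r ∈ Finset.range (n + 1), (m.multichoose r : ℂ) * X (m + r) * Z (n - r) +
      ∑ r ∈ Finset.range (m + 1), (n.multichoose r : ℂ) * Y (n + r) * W (m - r) := by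
  induction m generalizing n with
  | zero =>
    rw [Finset.sum_range_succ' _ n]
    simp [hX, hW, hZ]
  -- `H` is the coefficient form of the identity multiplied by `α + β`. Dividing by this factor
  -- amounts to solving for `X (m + 1) * Y n` in terms of `X m * Y (n + 1)`.
  | succ m ih =>
    have h1 := H m n
    have h2 := ih (n + 1)
    have h3 := sum_multichoose_pascal X Z m n
    have h4 := sum_multichoose_pascal Y W n m
    rw [show m + 1 + n = m + (n + 1) by omega, pow_succ]
    linear_combination h1 - h2 - h3 - h4

/-! ### The Kronecker series near `α = 0` -/

/-- The entire function `θ(α) / α`. -/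
noncomputable def thetaSlope (τ : ℂ) : ℂ → ℂ := dslope (theta τ) 0

theorem mul_thetaSlope (τ α : ℂ) : α * thetaSlope τ α = theta τ α := by
  have h := sub_smul_dslope (theta τ) 0 α
  rwa [theta_zero, sub_zero, sub_zero, smul_eq_mul] at h

theorem thetaSlope_zero (τ : ℂ) : thetaSlope τ 0 = deriv (theta τ) 0 := dslope_same _ _

theorem differentiable_thetaSlope (hτ : 0 < τ.im) : Differentiable ℂ (thetaSlope τ) := by
  rw [← differentiableOn_univ]
  exact (Complex.differentiableOn_dslope univ_mem).mpr (differentiable_theta hτ).differentiableOn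

theorem thetaSlope_neg (τ α : ℂ) : thetaSlope τ (-α) = thetaSlope τ α := by
  rcases eq_or_ne α 0 with rfl | h
  · simp
  · apply mul_left_cancel₀ h
    have h1 := mul_thetaSlope τ (-α)
    rw [theta_neg, ← mul_thetaSlope] at h1
    linear_combination -h1

theorem thetaSlope_zero_ne_zero (hτ : 0 < τ.im) : thetaSlope τ 0 ≠ 0 := by
  rw [thetaSlope_zero]; exact deriv_theta_zero_ne_zero hτ

/-- The function `α F_τ(ξ, α)` with its removable singularity at `α = 0` removed. -/
noncomputable def regKronecker (τ ξ α : ℂ) : ℂ :=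
  deriv (theta τ) 0 * theta τ (ξ + α) / (theta τ ξ * thetaSlope τ α)

theorem analyticAt_regKronecker (hτ : 0 < τ.im) {ξ α : ℂ} (hξ : theta τ ξ ≠ 0)
    (hα : thetaSlope τ α ≠ 0) : AnalyticAt ℂ (regKronecker τ ξ) α := by
  have h1 : AnalyticAt ℂ (fun α => theta τ (ξ + α)) α :=
    ((differentiable_theta hτ).comp (differentiable_id.const_add ξ)).analyticAt α
  have h2 := (differentiable_thetaSlope hτ).analyticAt α
  exact (analyticAt_const.mul h1).fun_div (analyticAt_const.mul h2) (mul_ne_zero hξ hα)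

theorem regKronecker_zero (hτ : 0 < τ.im) {ξ : ℂ} (hξ : theta τ ξ ≠ 0) :
    regKronecker τ ξ 0 = 1 := by
  rw [regKronecker, add_zero, thetaSlope_zero, mul_comm, div_self]
  exact mul_ne_zero hξ (deriv_theta_zero_ne_zero hτ)

theorem regKronecker_neg (τ ξ α : ℂ) : regKronecker τ (-ξ) α = regKronecker τ ξ (-α) := by
  rw [regKronecker, regKronecker, thetaSlope_neg, theta_neg,
    show -ξ + α = -(ξ + -α) by ring, theta_neg, mul_neg, neg_mul, neg_div_neg_eq]

theorem regKronecker_add_one (τ ξ α : ℂ) : regKronecker τ (ξ + 1) α = regKronecker τ ξ α := by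
  rw [regKronecker, regKronecker, theta_add_one, add_right_comm, theta_add_one, mul_neg, neg_mul,
    neg_div_neg_eq]

/-- This connects the definition of `f` with quotients of theta functions: for real `ξ` the
exponential factor is 1, and the value at `α = 0` is the limit of an analytic function. -/
theorem alphaOmega_eventuallyEq (hτ : 0 < τ.im) {ξ : ℂ} (hξ : theta τ ξ ≠ 0) (him : ξ.im = 0) :
    alphaOmega τ ξ =ᶠ[𝓝 0] regKronecker τ ξ := by
  have hS := (differentiable_thetaSlope hτ).continuous.continuousAt.eventually_ne
    (thetaSlope_zero_ne_zero hτ)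
  have h1 : (fun α => α * Omega τ ξ α) =ᶠ[𝓝[≠] 0] regKronecker τ ξ := by
    filter_upwards [hS.filter_mono nhdsWithin_le_nhds, self_mem_nhdsWithin] with α hα h0
    have h0' : α ≠ 0 := h0
    simp only [Omega, him, zero_div, Complex.ofReal_zero, mul_zero, zero_mul, Complex.exp_zero,
      one_mul, kronecker, regKronecker]
    rw [← mul_thetaSlope τ α]
    field_simp
  have h2 : Tendsto (fun α => α * Omega τ ξ α) (𝓝[≠] 0) (𝓝 (regKronecker τ ξ 0)) :=
    ((analyticAt_regKronecker hτ hξ (thetaSlope_zero_ne_zero hτ)).continuousAt.tendsto.mono_left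
      nhdsWithin_le_nhds).congr' h1.symm
  rw [eventuallyEq_nhdsWithin_iff] at h1
  filter_upwards [h1] with α hα
  rcases eq_or_ne α 0 with rfl | h
  · rw [alphaOmega, Function.update_self, h2.limUnder_eq]
  · rw [alphaOmega, Function.update_of_ne h, hα h]

/-- The Taylor coefficients of `α F_τ(ξ, α)` at `α = 0`. -/
noncomputable def kroneckerCoeff (τ : ℂ) (k : ℕ) (ξ : ℂ) : ℂ := taylorCoeff k (regKronecker τ ξ) 0

theorem f_eq_kroneckerCoeff (hτ : 0 < τ.im) {ξ : ℂ} (hξ : theta τ ξ ≠ 0) (him : ξ.im = 0) (k : ℕ) :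
    f τ k ξ = kroneckerCoeff τ k ξ :=
  taylorCoeff_congr (alphaOmega_eventuallyEq hτ hξ him) k

theorem kroneckerCoeff_zero (hτ : 0 < τ.im) {ξ : ℂ} (hξ : theta τ ξ ≠ 0) :
    kroneckerCoeff τ 0 ξ = 1 := by
  rw [kroneckerCoeff, taylorCoeff_zero, regKronecker_zero hτ hξ]

theorem kroneckerCoeff_neg (τ : ℂ) (k : ℕ) (ξ : ℂ) :
    kroneckerCoeff τ k (-ξ) = (-1) ^ k * kroneckerCoeff τ k ξ := by
  rw [kroneckerCoeff, kroneckerCoeff, ← taylorCoeff_comp_neg]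
  simp_rw [← regKronecker_neg]

theorem kroneckerCoeff_one_sub (τ : ℂ) (k : ℕ) (ξ : ℂ) :
    kroneckerCoeff τ k (1 - ξ) = (-1) ^ k * kroneckerCoeff τ k ξ := by
  rw [← kroneckerCoeff_neg, show 1 - ξ = -ξ + 1 by ring, kroneckerCoeff, kroneckerCoeff]
  congr 1
  ext α
  exact regKronecker_add_one τ _ α

/-- The numerator in the expression of the Taylor coefficients as quotients by `θ(ξ)`. -/
noncomputable def kroneckerNum (τ : ℂ) (k : ℕ) (ξ : ℂ) : ℂ :=
  ∑ i ∈ Finset.range (k + 1), taylorCoeff i (theta τ) ξ *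
    taylorCoeff (k - i) (fun α => deriv (theta τ) 0 / thetaSlope τ α) 0

theorem analyticAt_inv_thetaSlope (hτ : 0 < τ.im) :
    AnalyticAt ℂ (fun α => deriv (theta τ) 0 / thetaSlope τ α) 0 :=
  analyticAt_const.fun_div ((differentiable_thetaSlope hτ).analyticAt 0) (thetaSlope_zero_ne_zero hτ)

theorem kroneckerNum_eq (hτ : 0 < τ.im) (k : ℕ) (ξ : ℂ) : kroneckerNum τ k ξ =
    taylorCoeff k (fun α => theta τ (ξ + α) * (deriv (theta τ) 0 / thetaSlope τ α)) 0 := by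
  have h : AnalyticAt ℂ (fun α => theta τ (ξ + α)) 0 :=
    ((differentiable_theta hτ).comp (differentiable_id.const_add ξ)).analyticAt 0
  rw [taylorCoeff_mul h (analyticAt_inv_thetaSlope hτ), kroneckerNum]
  simp_rw [taylorCoeff_comp_const_add, add_zero]

theorem differentiable_kroneckerNum (hτ : 0 < τ.im) (k : ℕ) :
    Differentiable ℂ (kroneckerNum τ k) := by
  unfold kroneckerNum
  refine Differentiable.fun_sum fun i _ => ?_
  refine Differentiable.mul_const (fun z => ?_) _
  exact (analyticAt_taylorCoeff ((differentiable_theta hτ).analyticAt z) i).differentiableAt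

theorem kroneckerCoeff_eq_div (hτ : 0 < τ.im) (k : ℕ) (ξ : ℂ) :
    kroneckerCoeff τ k ξ = kroneckerNum τ k ξ / theta τ ξ := by
  rw [kroneckerNum_eq hτ, div_eq_mul_inv, ← taylorCoeff_mul_const, kroneckerCoeff]
  congr 1
  ext α
  rw [regKronecker, div_eq_mul_inv, mul_inv]
  ring

/-- At `ξ = 0` the generating function is `θ(α) θ'(0) / (θ(α)/α) = α θ'(0)`. Hence only `f^(1)` has
a pole at 0, and its residue is 1. -/
theorem kroneckerNum_zero (hτ : 0 < τ.im) (k : ℕ) :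
    kroneckerNum τ k 0 = if k = 1 then deriv (theta τ) 0 else 0 := by
  have hS := (differentiable_thetaSlope hτ).continuous.continuousAt.eventually_ne
    (thetaSlope_zero_ne_zero hτ)
  have h1 : (fun α => theta τ (0 + α) * (deriv (theta τ) 0 / thetaSlope τ α)) =ᶠ[𝓝 0]
      fun α => α * deriv (theta τ) 0 := by
    filter_upwards [hS] with α hα
    rw [zero_add, ← mul_thetaSlope]
    field_simp
  rw [kroneckerNum_eq hτ, taylorCoeff_congr h1, taylorCoeff_mul_const, taylorCoeff,
    iteratedDeriv_fun_id_zero]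
  split_ifs with h
  · simp [h]
  · simp

/-- The function `ξ f^(k)(ξ)` near `ξ = 0`. -/
theorem mul_kroneckerCoeff (hτ : 0 < τ.im) (k : ℕ) {ξ : ℂ} (hξ : theta τ ξ ≠ 0) :
    ξ * kroneckerCoeff τ k ξ = kroneckerNum τ k ξ / thetaSlope τ ξ := by
  have h := mul_thetaSlope τ ξ
  have h1 : ξ ≠ 0 := by rintro rfl; exact hξ (theta_zero τ)
  have h2 : thetaSlope τ ξ ≠ 0 := by intro h2; rw [h2, mul_zero] at h; exact hξ h.symm
  rw [kroneckerCoeff_eq_div hτ, ← h]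
  field_simp

/-! ### The Fay identity -/

/-- The Fay identity `F(x,a) F(y,b) = F(x,a+b) F(y-x,b) + F(y,a+b) F(x-y,a)` multiplied by `a b (a +
b)`. In this form it has no poles at `a = 0`, `b = 0` or `a + b = 0`, so Taylor coefficients can be
compared. -/
theorem regKronecker_fay (hτ : 0 < τ.im) {x y a b : ℂ} (hx : theta τ x ≠ 0) (hy : theta τ y ≠ 0)
    (hxy : theta τ (y - x) ≠ 0) (ha : thetaSlope τ a ≠ 0) (hb : thetaSlope τ b ≠ 0)
    (hab : thetaSlope τ (b + a) ≠ 0) :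
    (a * regKronecker τ x a + b * regKronecker τ x a) * regKronecker τ y b =
      a * regKronecker τ x (b + a) * regKronecker τ (y - x) b +
      b * (regKronecker τ y (b + a) * regKronecker τ (x - y) a) := by
  have h := theta_three_term hτ a b x y
  have h1 : theta τ (x - y) = -theta τ (y - x) := by rw [← theta_neg, neg_sub]
  simp only [regKronecker, h1]
  rw [← mul_thetaSlope τ (a + b), ← mul_thetaSlope τ a, ← mul_thetaSlope τ b, add_comm a b] at h
  rw [show x + a + b = x + (b + a) by ring, show y + a + b = y + (b + a) by ring] at h
  field_simp
  linear_combination deriv (theta τ) 0 ^ 2 * h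

/-- The coefficient of `α^(a+1) β^(b+1)` in `regKronecker_fay`. -/
theorem kroneckerCoeff_generating (hτ : 0 < τ.im) {x y : ℂ} (hx : theta τ x ≠ 0)
    (hy : theta τ y ≠ 0) (hyx : theta τ (y - x) ≠ 0) (a b : ℕ) :
    kroneckerCoeff τ a x * kroneckerCoeff τ (b + 1) y +
        kroneckerCoeff τ (a + 1) x * kroneckerCoeff τ b y =
      ∑ r ∈ Finset.range (b + 2), ((a + 1).multichoose r : ℂ) * kroneckerCoeff τ (a + r) x *
        kroneckerCoeff τ (b + 1 - r) (y - x) +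
      ∑ r ∈ Finset.range (a + 2), ((b + 1).multichoose r : ℂ) * kroneckerCoeff τ (b + r) y *
        kroneckerCoeff τ (a + 1 - r) (x - y) := by
  have hS0 := thetaSlope_zero_ne_zero hτ
  have hSc := (differentiable_thetaSlope hτ).continuous
  have hS : ∀ᶠ β in 𝓝 0, thetaSlope τ β ≠ 0 := hSc.continuousAt.eventually_ne hS0
  have hxy : theta τ (x - y) ≠ 0 := by rwa [← neg_sub, theta_neg, neg_ne_zero]
  have hid : AnalyticAt ℂ (fun w : ℂ => w) 0 := analyticAt_id
  have hX := analyticAt_regKronecker hτ hx hS0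
  have hY := analyticAt_regKronecker hτ hy hS0
  have hZ := analyticAt_regKronecker hτ hyx hS0
  have hW := analyticAt_regKronecker hτ hxy hS0
  -- The coefficient of `α^(a+1)` for fixed `β`. Expanding `X(β + α)` in `α` leaves Taylor
  -- coefficients at `β`, which are expanded in `β` afterwards.
  have step : ∀ᶠ β in 𝓝 0,
      kroneckerCoeff τ a x * regKronecker τ y β +
        β * (kroneckerCoeff τ (a + 1) x * regKronecker τ y β) =
      taylorCoeff a (regKronecker τ x) β * regKronecker τ (y - x) β +
      β * ∑ i ∈ Finset.range (a + 2), taylorCoeff i (regKronecker τ y) β *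
        kroneckerCoeff τ (a + 1 - i) (x - y) := by
    filter_upwards [hS] with β hβ
    have hXβ : AnalyticAt ℂ (fun α => regKronecker τ x (β + α)) 0 :=
      (analyticAt_regKronecker hτ hx (α := β + 0) (by rwa [add_zero])).comp
        (analyticAt_const.add analyticAt_id)
    have hYβ : AnalyticAt ℂ (fun α => regKronecker τ y (β + α)) 0 :=
      (analyticAt_regKronecker hτ hy (α := β + 0) (by rwa [add_zero])).comp
        (analyticAt_const.add analyticAt_id)
    have hSβ : ∀ᶠ α in 𝓝 0, thetaSlope τ (β + α) ≠ 0 :=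
      (hSc.comp (continuous_const_add β)).continuousAt.eventually_ne (by simpa using hβ)
    have hev : (fun α => (α * regKronecker τ x α + β * regKronecker τ x α) * regKronecker τ y β)
        =ᶠ[𝓝 0] fun α => α * regKronecker τ x (β + α) * regKronecker τ (y - x) β +
          β * (regKronecker τ y (β + α) * regKronecker τ (x - y) α) := by
      filter_upwards [hS, hSβ] with α hα hβα
      exact regKronecker_fay hτ hx hy hyx hα hβ hβα
    have h := taylorCoeff_congr hev (a + 1)
    rw [taylorCoeff_mul_const, taylorCoeff_add (hid.fun_mul hX) (analyticAt_const.fun_mul hX),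
      taylorCoeff_id_mul hX, taylorCoeff_const_mul,
      taylorCoeff_add ((hid.fun_mul hXβ).fun_mul analyticAt_const)
        (analyticAt_const.fun_mul (hYβ.fun_mul hW)), taylorCoeff_mul_const, taylorCoeff_id_mul hXβ,
      taylorCoeff_const_mul, taylorCoeff_mul hYβ hW] at h
    simp only [taylorCoeff_comp_const_add, add_zero] at h
    simp only [kroneckerCoeff]
    linear_combination h
  have h := taylorCoeff_congr step (b + 1)
  have hTY : ∀ i ∈ Finset.range (a + 2), AnalyticAt ℂ (fun β => taylorCoeff i (regKronecker τ y) β *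
      kroneckerCoeff τ (a + 1 - i) (x - y)) 0 :=
    fun i _ => (analyticAt_taylorCoeff hY i).fun_mul analyticAt_const
  have hsum := Finset.analyticAt_fun_sum _ hTY
  rw [taylorCoeff_add (analyticAt_const.fun_mul hY) (hid.fun_mul (analyticAt_const.fun_mul hY)),
    taylorCoeff_const_mul, taylorCoeff_id_mul (analyticAt_const.fun_mul hY), taylorCoeff_const_mul,
    taylorCoeff_add ((analyticAt_taylorCoeff hX a).fun_mul hZ) (hid.fun_mul hsum),
    taylorCoeff_mul (analyticAt_taylorCoeff hX a) hZ, taylorCoeff_id_mul hsum,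
    taylorCoeff_sum _ hTY] at h
  simp only [taylorCoeff_mul_const, taylorCoeff_taylorCoeff] at h
  refine h.trans ?_
  congr 1
  refine Finset.sum_congr rfl fun i _ => ?_
  have hm : (i + 1).multichoose b = (b + 1).multichoose i := by
    rw [Nat.multichoose_eq, Nat.multichoose_eq, show i + 1 + b - 1 = i + b by omega,
      show b + 1 + i - 1 = b + i by omega, add_comm i b, Nat.choose_symm_add]
  rw [hm, add_comm i b]
  rfl

theorem kroneckerCoeff_fay (hτ : 0 < τ.im) {x y : ℂ} (hx : theta τ x ≠ 0)
    (hy : theta τ y ≠ 0) (hyx : theta τ (y - x) ≠ 0) (m n : ℕ) :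
    kroneckerCoeff τ m x * kroneckerCoeff τ n y =
      -((-1) ^ m * kroneckerCoeff τ (m + n) (y - x)) +
      ∑ r ∈ Finset.range (n + 1), (m.multichoose r : ℂ) * kroneckerCoeff τ (m + r) x *
        kroneckerCoeff τ (n - r) (y - x) +
      ∑ r ∈ Finset.range (m + 1), (n.multichoose r : ℂ) * kroneckerCoeff τ (n + r) y *
        ((-1) ^ (m - r) * kroneckerCoeff τ (m - r) (y - x)) := by
  refine fay_of_generating (fun k => kroneckerCoeff τ k x) (fun k => kroneckerCoeff τ k y)
    (fun k => kroneckerCoeff τ k (y - x)) (fun k => (-1) ^ k * kroneckerCoeff τ k (y - x))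
    (kroneckerCoeff_zero hτ hx) (kroneckerCoeff_zero hτ hyx) (fun _ => rfl) (fun a b => ?_) m n
  simp_rw [← kroneckerCoeff_neg, neg_sub]
  exact kroneckerCoeff_generating hτ hx hy hyx a b

/-! ### The functions `f^(k)` on the unit interval -/

/-- The function `π cot(πs)`. -/
noncomputable def cotPi (s : ℝ) : ℝ := Real.pi * Real.cos (Real.pi * s) / Real.sin (Real.pi * s)

theorem sin_pi_mul_pos {s : ℝ} (hs : s ∈ Set.Ioo (0 : ℝ) 1) : 0 < Real.sin (Real.pi * s) :=
  Real.sin_pos_of_pos_of_lt_pi (mul_pos Real.pi_pos hs.1)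
    (by nlinarith [Real.pi_pos, hs.2])

theorem continuousOn_cotPi : ContinuousOn cotPi (Set.Ioo 0 1) := by
  unfold cotPi
  exact ContinuousOn.div (by fun_prop) (by fun_prop) fun s hs => (sin_pi_mul_pos hs).ne'

theorem cotPi_one_sub (s : ℝ) : cotPi (1 - s) = -cotPi s := by
  rw [cotPi, cotPi, mul_sub, mul_one, Real.cos_pi_sub, Real.sin_pi_sub, mul_neg, neg_div]

/-- A sequence of functions on the unit interval with the properties of the functions `f^(k)` that
govern their iterated integrals of length two. -/
structure IsFaySystem (φ : ℕ → ℝ → ℂ) : Prop where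
  zero : ∀ s ∈ Set.Ioo (0 : ℝ) 1, φ 0 s = 1
  reflect : ∀ k, ∀ s ∈ Set.Ioo (0 : ℝ) 1, φ k (1 - s) = (-1) ^ k * φ k s
  regular : ∀ k, k ≠ 1 → ∃ g : ℝ → ℂ, Continuous g ∧ Set.EqOn (φ k) g (Set.Ioo 0 1)
  singular : ∃ h : ℝ → ℂ, Continuous h ∧ ∀ s ∈ Set.Ioo (0 : ℝ) 1, φ 1 s = cotPi s + h s
  fay : ∀ m n s u, 0 < s → s < u → u < 1 → φ m s * φ n u =
      -((-1) ^ m * φ (m + n) (u - s)) +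
      ∑ r ∈ Finset.range (n + 1), (m.multichoose r : ℂ) * φ (m + r) s * φ (n - r) (u - s) +
      ∑ r ∈ Finset.range (m + 1), (n.multichoose r : ℂ) * φ (n + r) u *
        ((-1) ^ (m - r) * φ (m - r) (u - s))

/-- A function on the unit interval with a parity under `s ↦ 1 - s` and a limit at `0` extends
continuously. -/
theorem exists_continuous_extension {ψ : ℝ → ℂ} (hψ : ContinuousOn ψ (Set.Ioo 0 1)) {c l : ℂ}
    (hc : ∀ s ∈ Set.Ioo (0 : ℝ) 1, ψ (1 - s) = c * ψ s) (hl : Tendsto ψ (𝓝[>] 0) (𝓝 l)) :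
    ∃ g : ℝ → ℂ, Continuous g ∧ Set.EqOn ψ g (Set.Ioo 0 1) := by
  have h1 : Tendsto (fun s : ℝ => 1 - s) (𝓝[<] 1) (𝓝[>] 0) := by
    refine tendsto_nhdsWithin_iff.mpr ⟨?_, ?_⟩
    · have : Tendsto (fun s : ℝ => 1 - s) (𝓝 1) (𝓝 (1 - 1)) := tendsto_id.const_sub 1
      rw [sub_self] at this
      exact this.mono_left nhdsWithin_le_nhds
    · filter_upwards [self_mem_nhdsWithin] with s hs
      exact sub_pos.mpr (Set.mem_Iio.mp hs)
  have h2 : Tendsto ψ (𝓝[<] 1) (𝓝 (c * l)) := by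
    refine ((hl.comp h1).const_mul c).congr' ?_
    filter_upwards [Ioo_mem_nhdsLT (zero_lt_one (α := ℝ))] with s hs
    rw [Function.comp_apply, ← hc _ ⟨sub_pos.mpr hs.2, by linarith [hs.1]⟩, sub_sub_cancel]
  have h3 := continuousOn_Icc_extendFrom_Ioo hψ hl h2
  refine ⟨Set.IccExtend zero_le_one ((Set.Icc 0 1).domRestrict (extendFrom (Set.Ioo 0 1) ψ)),
    h3.domRestrict.Icc_extend', fun s hs => ?_⟩
  rw [Set.IccExtend_of_mem _ _ (⟨hs.1.le, hs.2.le⟩ : s ∈ Set.Icc (0 : ℝ) 1), Set.domRestrict_apply,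
    extendFrom_eq (subset_closure hs) (hψ s hs)]

/-- `ψ(s)` is the difference quotient of `b` at 0, which gives the boundary limit needed by
`exists_continuous_extension`. -/
theorem tendsto_of_mul_eq {ψ : ℝ → ℂ} {b : ℂ → ℂ} (hb : DifferentiableAt ℂ b 0) (hb0 : b 0 = 0)
    (h : ∀ s ∈ Set.Ioo (0 : ℝ) 1, s * ψ s = b s) : Tendsto ψ (𝓝[>] 0) (𝓝 (deriv b 0)) := by
  have h0 : HasDerivAt b (deriv b 0) ((0 : ℝ) : ℂ) := by simpa using hb.hasDerivAt
  have h1 := (hasDerivAt_iff_tendsto_slope.mp h0.comp_ofReal).mono_left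
    (nhdsWithin_mono 0 (fun s (hs : 0 < s) => hs.ne'))
  refine h1.congr' ?_
  filter_upwards [Ioo_mem_nhdsGT (zero_lt_one (α := ℝ))] with s hs
  have hs0 : (s : ℂ) ≠ 0 := by exact_mod_cast hs.1.ne'
  rw [slope_def_module, Complex.ofReal_zero, hb0, ← h s hs, sub_zero, sub_zero,
    Complex.real_smul, Complex.ofReal_inv, inv_mul_cancel_left₀ hs0]

theorem f_ofReal_eq (hτ : 0 < τ.im) (k : ℕ) {s : ℝ} (hs : s ∈ Set.Ioo (0 : ℝ) 1) :
    f τ k s = kroneckerCoeff τ k s :=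
  f_eq_kroneckerCoeff hτ (theta_ofReal_ne_zero hτ hs) (Complex.ofReal_im s) k

theorem f_one_sub (hτ : 0 < τ.im) (k : ℕ) {s : ℝ} (hs : s ∈ Set.Ioo (0 : ℝ) 1) :
    f τ k ((1 - s : ℝ) : ℂ) = (-1) ^ k * f τ k s := by
  rw [f_ofReal_eq hτ k hs, f_ofReal_eq hτ k ⟨sub_pos.mpr hs.2, by linarith [hs.1]⟩,
    ← kroneckerCoeff_one_sub, Complex.ofReal_sub, Complex.ofReal_one]

theorem continuousOn_f (hτ : 0 < τ.im) (k : ℕ) :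
    ContinuousOn (fun s : ℝ => f τ k s) (Set.Ioo 0 1) := by
  have h : ContinuousOn (fun s : ℝ => kroneckerNum τ k s / theta τ s) (Set.Ioo 0 1) :=
    ((differentiable_kroneckerNum hτ k).continuous.comp Complex.continuous_ofReal).continuousOn.div
      ((differentiable_theta hτ).continuous.comp Complex.continuous_ofReal).continuousOn
      fun s hs => theta_ofReal_ne_zero hτ hs
  refine h.congr fun s hs => ?_
  dsimp only
  rw [f_ofReal_eq hτ k hs, kroneckerCoeff_eq_div hτ]

theorem differentiableAt_kroneckerNum_div (hτ : 0 < τ.im) (k : ℕ) :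
    DifferentiableAt ℂ (fun ξ => kroneckerNum τ k ξ / thetaSlope τ ξ) 0 :=
  (differentiable_kroneckerNum hτ k 0).fun_div (differentiable_thetaSlope hτ 0)
    (thetaSlope_zero_ne_zero hτ)

theorem isFaySystem_f (hτ : 0 < τ.im) : IsFaySystem fun k s => f τ k s where
  zero s hs := by
    rw [f_ofReal_eq hτ 0 hs, kroneckerCoeff_zero hτ (theta_ofReal_ne_zero hτ hs)]
  reflect k s hs := f_one_sub hτ k hs
  regular k hk := by
    refine exists_continuous_extension (continuousOn_f hτ k) (fun s hs => f_one_sub hτ k hs)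
      (tendsto_of_mul_eq (differentiableAt_kroneckerNum_div hτ k) ?_ fun s hs => ?_)
    · rw [kroneckerNum_zero hτ, if_neg hk, zero_div]
    · rw [f_ofReal_eq hτ k hs, mul_kroneckerCoeff hτ k (theta_ofReal_ne_zero hτ hs)]
  singular := by
    have hsin : Differentiable ℂ fun z : ℂ => Complex.sin (Real.pi * z) := by fun_prop
    have hσ : Differentiable ℂ (dslope (fun z : ℂ => Complex.sin (Real.pi * z)) 0) := by
      rw [← differentiableOn_univ]
      exact (Complex.differentiableOn_dslope univ_mem).mpr hsin.differentiableOn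
    have hσ0 : dslope (fun z : ℂ => Complex.sin (Real.pi * z)) 0 0 = Real.pi := by
      have : HasDerivAt (fun z : ℂ => Complex.sin (Real.pi * z))
          (Complex.cos (Real.pi * 0) * (Real.pi * 1)) 0 :=
        ((hasDerivAt_id (0 : ℂ)).const_mul (Real.pi : ℂ)).csin
      rw [dslope_same, this.deriv]
      simp
    have hpi : (Real.pi : ℂ) ≠ 0 := by exact_mod_cast Real.pi_ne_zero
    -- Both `s f^(1)(s)` and `s π cot(πs)` extend analytically to `s = 0` with value 1, so their
    -- difference vanishes there. The function `b` below is that difference, and oddness under `s ↦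
    -- 1 - s` handles the other endpoint.
    obtain ⟨g, hg, hfg⟩ := exists_continuous_extension (ψ := fun s => f τ 1 s - cotPi s) (c := -1)
      ((continuousOn_f hτ 1).sub (Complex.continuous_ofReal.comp_continuousOn continuousOn_cotPi))
      (fun s hs => by
        rw [f_one_sub hτ 1 hs, cotPi_one_sub]
        push_cast
        ring)
      (tendsto_of_mul_eq (b := fun ξ => kroneckerNum τ 1 ξ / thetaSlope τ ξ -
          Real.pi * Complex.cos (Real.pi * ξ) /
            dslope (fun z : ℂ => Complex.sin (Real.pi * z)) 0 ξ)
        ((differentiableAt_kroneckerNum_div hτ 1).sub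
          (DifferentiableAt.fun_div (by fun_prop) (hσ 0) (by rwa [hσ0])))
        (by
          rw [hσ0, kroneckerNum_zero hτ, if_pos rfl, thetaSlope_zero,
            div_self (deriv_theta_zero_ne_zero hτ)]
          simp [hpi])
        (fun s hs => by
          have h1 := sub_smul_dslope (fun z : ℂ => Complex.sin (Real.pi * z)) 0 s
          have h2 : Complex.sin (Real.pi * s) ≠ 0 := by
            exact_mod_cast (sin_pi_mul_pos hs).ne'
          simp only [mul_zero, Complex.sin_zero, sub_zero, smul_eq_mul] at h1
          have h3 : dslope (fun z : ℂ => Complex.sin (Real.pi * z)) 0 s ≠ 0 := by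
            intro h3; rw [h3, mul_zero] at h1; exact h2 h1.symm
          have h4 : (s : ℂ) ≠ 0 := by exact_mod_cast hs.1.ne'
          rw [f_ofReal_eq hτ 1 hs, mul_sub, mul_kroneckerCoeff hτ 1 (theta_ofReal_ne_zero hτ hs),
            cotPi]
          push_cast
          rw [← h1]
          field_simp))
    exact ⟨g, hg, fun s hs => by rw [← hfg hs]; ring⟩
  fay m n s u h0 h1 h2 := by
    have hs : s ∈ Set.Ioo (0 : ℝ) 1 := ⟨h0, h1.trans h2⟩
    have hu : u ∈ Set.Ioo (0 : ℝ) 1 := ⟨h0.trans h1, h2⟩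
    have hus : u - s ∈ Set.Ioo (0 : ℝ) 1 := ⟨sub_pos.mpr h1, by linarith⟩
    simp only [f_ofReal_eq hτ _ hs, f_ofReal_eq hτ _ hu, f_ofReal_eq hτ _ hus]
    have h3 := theta_ofReal_ne_zero hτ hus
    push_cast at h3 ⊢
    exact kroneckerCoeff_fay hτ (theta_ofReal_ne_zero hτ hs) (theta_ofReal_ne_zero hτ hu) h3 m n

/-! ### Integrals over simplices of length one and two -/

/-- The integral over the truncated unit interval. -/
noncomputable def segmentInt (φ : ℝ → ℂ) (ε : ℝ) : ℂ := ∫ s in ε..1 - ε, φ s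

/-- The iterated integral of length two over the truncated unit interval. -/
noncomputable def simplexInt (φ ψ : ℝ → ℂ) (ε : ℝ) : ℂ :=
  ∫ s in ε..1 - ε, φ s * ∫ u in s..1 - ε, ψ u

/-- The integral over the simplex `s ≥ ε`, `u - s ≥ ε`, `1 - u ≥ ε`. -/
noncomputable def gapInt (K : ℝ → ℝ → ℂ) (ε : ℝ) : ℂ :=
  ∫ s in ε..1 - 2 * ε, ∫ u in s + ε..1 - ε, K s u

/-- The analogue of `simplexInt` over the simplex `s ≥ ε`, `u - s ≥ ε`, `1 - u ≥ ε`. -/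
noncomputable def gapSimplexInt (φ ψ : ℝ → ℂ) (ε : ℝ) : ℂ := gapInt (fun s u => φ s * ψ u) ε

open MeasureTheory in
/-- Interchange of integrations over a triangle. -/
theorem integral_triangle_swap {K : ℝ → ℝ → ℂ} (hK : Continuous K.uncurry) {a b : ℝ} (hab : a ≤ b) :
    ∫ s in a..b, ∫ u in s..b, K s u = ∫ u in a..b, ∫ s in a..u, K s u := by
  have hI : IntegrableOn (Function.uncurry fun s u => (Set.Ioi s).indicator (K s) u)
      (Set.uIoc a b ×ˢ Set.uIoc a b) := by
    have h1 : (Function.uncurry fun s u => (Set.Ioi s).indicator (K s) u) =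
        {p : ℝ × ℝ | p.1 < p.2}.indicator K.uncurry := by
      ext ⟨s, u⟩
      simp [Set.indicator_apply]
    rw [h1]
    refine IntegrableOn.indicator ?_ (measurableSet_lt measurable_fst measurable_snd)
    refine (hK.continuousOn.integrableOn_compact
      (isCompact_Icc.prod (isCompact_Icc (a := a) (b := b)) : IsCompact (Set.Icc a b ×ˢ _))).mono_set ?_
    rw [Set.uIoc_of_le hab]
    exact Set.prod_mono Set.Ioc_subset_Icc_self Set.Ioc_subset_Icc_self
  have h := intervalIntegral_intervalIntegral_swap hI
  have hl : ∫ s in a..b, ∫ u in s..b, K s u =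
      ∫ s in a..b, ∫ u in a..b, (Set.Ioi s).indicator (K s) u := by
    refine intervalIntegral.integral_congr fun s hs => ?_
    rw [Set.uIcc_of_le hab] at hs
    rw [intervalIntegral.integral_of_le hab, intervalIntegral.integral_of_le hs.2,
      setIntegral_indicator measurableSet_Ioi, Set.Ioc_inter_Ioi, max_eq_right hs.1]
  have hr : ∫ u in a..b, ∫ s in a..u, K s u =
      ∫ u in a..b, ∫ s in a..b, (Set.Ioi s).indicator (K s) u := by
    refine intervalIntegral.integral_congr fun u hu => ?_
    rw [Set.uIcc_of_le hab] at hu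
    have h2 : ∀ s, (Set.Ioi s).indicator (K s) u = (Set.Iio u).indicator (fun s => K s u) s := by
      intro s; simp [Set.indicator_apply]
    simp_rw [h2]
    rw [intervalIntegral.integral_of_le hab, intervalIntegral.integral_of_le hu.1,
      setIntegral_indicator measurableSet_Iio]
    have h3 : Set.Ioc a b ∩ Set.Iio u = Set.Ioo a u := by
      ext x
      simp only [Set.mem_inter_iff, Set.mem_Ioc, Set.mem_Iio, Set.mem_Ioo]
      exact ⟨fun h => ⟨h.1.1, h.2⟩, fun h => ⟨⟨h.1, h.2.le.trans hu.2⟩, h.2⟩⟩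
    rw [h3]
    exact setIntegral_congr_set Ioo_ae_eq_Ioc.symm
  rw [hl, h, hr]

variable {ε : ℝ}

theorem gapInt_congr (hε : ε ≤ 1 / 3) {K K' : ℝ → ℝ → ℂ}
    (h : ∀ s u, ε ≤ s → s + ε ≤ u → u ≤ 1 - ε → K s u = K' s u) : gapInt K ε = gapInt K' ε := by
  refine intervalIntegral.integral_congr fun s hs => intervalIntegral.integral_congr fun u hu => ?_
  rw [Set.uIcc_of_le (by linarith)] at hs
  rw [Set.uIcc_of_le (by linarith [hs.2])] at hu
  exact h s u hs.1 hu.1 hu.2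

theorem continuous_gapInt_inner {K : ℝ → ℝ → ℂ} (hK : Continuous K.uncurry) (ε : ℝ) :
    Continuous fun s => ∫ u in s + ε..1 - ε, K s u := by
  have h : ∀ s, ∫ u in s + ε..1 - ε, K s u = -∫ u in 1 - ε..s + ε, K s u := fun s =>
    intervalIntegral.integral_symm _ _
  simp_rw [h]
  exact (intervalIntegral.continuous_parametric_intervalIntegral_of_continuous hK
    (continuous_id.add_const ε)).neg

theorem gapInt_add {K L : ℝ → ℝ → ℂ} (hK : Continuous K.uncurry) (hL : Continuous L.uncurry) :
    gapInt (fun s u => K s u + L s u) ε = gapInt K ε + gapInt L ε := by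
  rw [gapInt, gapInt, gapInt, ← intervalIntegral.integral_add
    ((continuous_gapInt_inner hK ε).intervalIntegrable _ _)
    ((continuous_gapInt_inner hL ε).intervalIntegrable _ _)]
  congr 1
  ext s
  exact intervalIntegral.integral_add
    ((hK.comp (Continuous.prodMk_right s)).intervalIntegrable _ _)
    ((hL.comp (Continuous.prodMk_right s)).intervalIntegrable _ _)

theorem gapInt_const_mul (c : ℂ) (K : ℝ → ℝ → ℂ) :
    gapInt (fun s u => c * K s u) ε = c * gapInt K ε := by
  simp only [gapInt, intervalIntegral.integral_const_mul]

theorem gapInt_sum {ι : Type*} (t : Finset ι) {K : ι → ℝ → ℝ → ℂ}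
    (hK : ∀ i, Continuous (K i).uncurry) :
    gapInt (fun s u => ∑ i ∈ t, K i s u) ε = ∑ i ∈ t, gapInt (K i) ε := by
  classical
  induction t using Finset.induction_on with
  | empty => simp [gapInt]
  | insert i t hi ih =>
    simp only [Finset.sum_insert hi]
    rw [gapInt_add (hK i), ih]
    exact continuous_finsetSum t fun j _ => hK j

/-- The integration over the first variable first. -/
theorem gapInt_swap (hε : ε ≤ 1 / 3) {K : ℝ → ℝ → ℂ} (hK : Continuous K.uncurry) :
    gapInt K ε = ∫ u in 2 * ε..1 - ε, ∫ s in ε..u - ε, K s u := by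
  -- Shifting `u` by `ε` turns the region into an ordinary triangle.
  have h1 : ∀ s, ∫ u in s + ε..1 - ε, K s u = ∫ u in s..1 - 2 * ε, K s (u + ε) := by
    intro s
    rw [intervalIntegral.integral_comp_add_right, show 1 - 2 * ε + ε = 1 - ε by ring]
  have h2 : Continuous (Function.uncurry fun s u => K s (u + ε)) :=
    hK.comp (continuous_fst.prodMk (continuous_snd.add_const ε))
  rw [gapInt]
  simp_rw [h1]
  rw [integral_triangle_swap h2 (by linarith)]
  have h3 := intervalIntegral.integral_comp_add_right (a := ε) (b := 1 - 2 * ε)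
    (fun u => ∫ s in ε..u - ε, K s u) ε
  simp only [add_sub_cancel_right] at h3
  rw [h3, show ε + ε = 2 * ε by ring, show 1 - 2 * ε + ε = 1 - ε by ring]

theorem gapSimplexInt_eq (φ ψ : ℝ → ℂ) (ε : ℝ) :
    gapSimplexInt φ ψ ε = ∫ s in ε..1 - 2 * ε, φ s * ∫ u in s + ε..1 - ε, ψ u := by
  simp only [gapSimplexInt, gapInt, intervalIntegral.integral_const_mul]

theorem continuous_uncurry_mul {φ ψ : ℝ → ℂ} (hφ : Continuous φ) (hψ : Continuous ψ) :
    Continuous (Function.uncurry fun s u => φ s * ψ u) :=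
  (hφ.comp continuous_fst).mul (hψ.comp continuous_snd)

/-- Parity under `s ↦ 1 - s` on the truncated unit interval. -/
def HasParity (φ : ℝ → ℂ) (a : ℂ) (ε : ℝ) : Prop := ∀ s ∈ Set.Icc ε (1 - ε), φ (1 - s) = a * φ s

theorem HasParity.integral_eq {φ : ℝ → ℂ} {a : ℂ} (h : HasParity φ a ε) {x y : ℝ}
    (hx : ε ≤ x) (hxy : x ≤ y) (hy : y ≤ 1 - ε) :
    ∫ s in 1 - y..1 - x, φ s = a * ∫ s in x..y, φ s := by
  rw [← intervalIntegral.integral_comp_sub_left, ← intervalIntegral.integral_const_mul]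
  refine intervalIntegral.integral_congr fun s hs => ?_
  rw [Set.uIcc_of_le hxy] at hs
  exact h s ⟨hx.trans hs.1, hs.2.trans hy⟩

theorem HasParity.segmentInt_eq {φ : ℝ → ℂ} {a : ℂ} (h : HasParity φ a ε) (hε : ε ≤ 1 / 2) :
    segmentInt φ ε = a * segmentInt φ ε := by
  have h1 := h.integral_eq le_rfl (by linarith) le_rfl
  rwa [sub_sub_cancel] at h1

/-- The substitution `(s, u) ↦ (1 - u, 1 - s)` preserves the truncated simplex and exchanges the two
functions. -/
theorem simplexInt_reflect (hε : ε ≤ 1 / 2) {φ ψ : ℝ → ℂ} (hφ : Continuous φ) (hψ : Continuous ψ)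
    {a b : ℂ} (ha : HasParity φ a ε) (hb : HasParity ψ b ε) :
    simplexInt φ ψ ε = a * b * simplexInt ψ φ ε := by
  have h1 : simplexInt φ ψ ε = ∫ u in ε..1 - ε, ψ u * ∫ s in ε..u, φ s := by
    simp only [simplexInt, ← intervalIntegral.integral_const_mul]
    rw [integral_triangle_swap (continuous_uncurry_mul hφ hψ) (by linarith)]
    simp_rw [mul_comm (ψ _)]
  rw [h1, simplexInt, ← intervalIntegral.integral_const_mul]
  have h2 := intervalIntegral.integral_comp_sub_left (a := ε) (b := 1 - ε)
    (fun u => ψ u * ∫ s in ε..u, φ s) 1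
  rw [sub_sub_cancel] at h2
  rw [← h2]
  refine intervalIntegral.integral_congr fun s hs => ?_
  rw [Set.uIcc_of_le (by linarith)] at hs
  have h3 := ha.integral_eq hs.1 hs.2 le_rfl
  rw [sub_sub_cancel] at h3
  rw [h3, hb s hs]
  ring

theorem gapSimplexInt_swap (hε : ε ≤ 1 / 3) {φ ψ : ℝ → ℂ} (hφ : Continuous φ) (hψ : Continuous ψ) :
    gapSimplexInt φ ψ ε = ∫ u in 2 * ε..1 - ε, ψ u * ∫ s in ε..u - ε, φ s := by
  rw [gapSimplexInt, gapInt_swap hε (continuous_uncurry_mul hφ hψ)]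
  simp_rw [mul_comm (ψ _), intervalIntegral.integral_mul_const]

theorem gapSimplexInt_reflect (hε : 0 < ε) (hε' : ε ≤ 1 / 3) {φ ψ : ℝ → ℂ} (hφ : Continuous φ)
    (hψ : Continuous ψ) {a b : ℂ} (ha : HasParity φ a ε) (hb : HasParity ψ b ε) :
    gapSimplexInt φ ψ ε = a * b * gapSimplexInt ψ φ ε := by
  rw [gapSimplexInt_swap hε' hφ hψ, gapSimplexInt_eq, ← intervalIntegral.integral_const_mul]
  have h2 := intervalIntegral.integral_comp_sub_left (a := ε) (b := 1 - 2 * ε)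
    (fun u => ψ u * ∫ s in ε..u - ε, φ s) 1
  rw [sub_sub_cancel] at h2
  rw [← h2]
  refine intervalIntegral.integral_congr fun s hs => ?_
  rw [Set.uIcc_of_le (by linarith)] at hs
  have h3 := ha.integral_eq (x := s + ε) (y := 1 - ε) (by linarith [hs.1]) (by linarith [hs.2]) le_rfl
  rw [sub_sub_cancel, ← sub_sub] at h3
  rw [h3, hb s ⟨hs.1, by linarith [hs.2]⟩]
  ring

/-- Exchange of the gaps `u - s` and `1 - u`, followed by the parity of `ψ`. -/
theorem gapInt_mul_comp_sub_left (hε : 0 < ε) (hε' : ε ≤ 1 / 3) (φ : ℝ → ℂ) {ψ : ℝ → ℂ} {b : ℂ}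
    (hb : HasParity ψ b ε) :
    gapInt (fun s u => φ s * ψ (u - s)) ε = b * gapSimplexInt φ ψ ε := by
  rw [gapSimplexInt_eq, gapInt, ← intervalIntegral.integral_const_mul]
  refine intervalIntegral.integral_congr fun s hs => ?_
  rw [Set.uIcc_of_le (by linarith)] at hs
  have h3 := hb.integral_eq (x := s + ε) (y := 1 - ε) (by linarith [hs.1]) (by linarith [hs.2]) le_rfl
  rw [intervalIntegral.integral_const_mul, intervalIntegral.integral_comp_sub_right,
    add_sub_cancel_left, show 1 - ε - s = 1 - (s + ε) by ring]
  rw [sub_sub_cancel] at h3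
  rw [h3]
  ring

/-- Exchange of the gaps `s` and `u - s` for fixed `u`. -/
theorem gapInt_mul_comp_sub_right (hε' : ε ≤ 1 / 3) {φ ψ : ℝ → ℂ} (hφ : Continuous φ)
    (hψ : Continuous ψ) :
    gapInt (fun s u => φ u * ψ (u - s)) ε = gapSimplexInt ψ φ ε := by
  have h : Continuous (Function.uncurry fun s u => φ u * ψ (u - s)) :=
    (hφ.comp continuous_snd).mul (hψ.comp (continuous_snd.sub continuous_fst))
  rw [gapInt_swap hε' h, gapSimplexInt_swap hε' hψ hφ]
  congr 1
  ext u
  rw [intervalIntegral.integral_const_mul, intervalIntegral.integral_comp_sub_left, sub_sub_cancel]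

theorem simplexInt_shuffle (hε : ε ≤ 1 / 2) {φ ψ : ℝ → ℂ} (hφ : Continuous φ) (hψ : Continuous ψ) :
    simplexInt φ ψ ε + simplexInt ψ φ ε = segmentInt φ ε * segmentInt ψ ε := by
  have h1 : simplexInt ψ φ ε = ∫ u in ε..1 - ε, φ u * ∫ s in ε..u, ψ s := by
    simp only [simplexInt, ← intervalIntegral.integral_const_mul]
    rw [integral_triangle_swap (continuous_uncurry_mul hψ hφ) (by linarith)]
    simp_rw [mul_comm (φ _)]
  have hi : ∀ x y, IntervalIntegrable ψ MeasureTheory.volume x y := hψ.intervalIntegrable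
  have hc : Continuous fun s => ∫ u in ε..s, ψ u := intervalIntegral.continuous_primitive hi ε
  have hc' : Continuous fun s => ∫ u in s..1 - ε, ψ u := by
    simp_rw [intervalIntegral.integral_symm (1 - ε)]
    exact (intervalIntegral.continuous_primitive hi _).neg
  rw [h1, simplexInt, ← intervalIntegral.integral_add ((hφ.fun_mul hc').intervalIntegrable _ _)
    ((hφ.fun_mul hc).intervalIntegrable _ _), segmentInt, segmentInt,
    ← intervalIntegral.integral_mul_const]
  congr 1
  ext s
  rw [← mul_add, add_comm, intervalIntegral.integral_add_adjacent_intervals (hi _ _) (hi _ _)]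

theorem segmentInt_congr (hε : ε ≤ 1 / 2) {φ φ' : ℝ → ℂ} (h : Set.EqOn φ φ' (Set.Icc ε (1 - ε))) :
    segmentInt φ ε = segmentInt φ' ε := by
  refine intervalIntegral.integral_congr fun s hs => ?_
  rw [Set.uIcc_of_le (by linarith)] at hs
  exact h hs

theorem simplexInt_congr (hε : ε ≤ 1 / 2) {φ φ' ψ ψ' : ℝ → ℂ}
    (h : Set.EqOn φ φ' (Set.Icc ε (1 - ε))) (h' : Set.EqOn ψ ψ' (Set.Icc ε (1 - ε))) :
    simplexInt φ ψ ε = simplexInt φ' ψ' ε := by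
  refine intervalIntegral.integral_congr fun s hs => ?_
  rw [Set.uIcc_of_le (by linarith)] at hs
  have h1 : ∫ u in s..1 - ε, ψ u = ∫ u in s..1 - ε, ψ' u := by
    refine intervalIntegral.integral_congr fun u hu => ?_
    rw [Set.uIcc_of_le hs.2] at hu
    exact h' ⟨hs.1.trans hu.1, hu.2⟩
  simp only [h hs, h1]

theorem gapSimplexInt_congr (hε : 0 < ε) (hε' : ε ≤ 1 / 3) {φ φ' ψ ψ' : ℝ → ℂ}
    (h : Set.EqOn φ φ' (Set.Icc ε (1 - ε))) (h' : Set.EqOn ψ ψ' (Set.Icc ε (1 - ε))) :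
    gapSimplexInt φ ψ ε = gapSimplexInt φ' ψ' ε := by
  refine gapInt_congr hε' fun s u h1 h2 h3 => ?_
  rw [h ⟨h1, by linarith⟩, h' ⟨by linarith, h3⟩]

theorem HasParity.congr {φ φ' : ℝ → ℂ} {a : ℂ} (ha : HasParity φ a ε)
    (h : Set.EqOn φ φ' (Set.Icc ε (1 - ε))) : HasParity φ' a ε := fun s hs => by
  rw [← h hs, ← h ⟨by linarith [hs.2], by linarith [hs.1]⟩, ha s hs]

theorem hasParity_of_Ioo (hε : 0 < ε) {φ : ℝ → ℂ} {a : ℂ}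
    (h : ∀ s ∈ Set.Ioo (0 : ℝ) 1, φ (1 - s) = a * φ s) : HasParity φ a ε :=
  fun s hs => h s ⟨by linarith [hs.1], by linarith [hs.2]⟩

/-- A function that is continuous on the open unit interval agrees with a continuous function on a
truncated unit interval. -/
theorem exists_continuous_eqOn (hε : 0 < ε) (hε' : ε ≤ 1 / 2) {φ : ℝ → ℂ}
    (hφ : ContinuousOn φ (Set.Ioo 0 1)) :
    ∃ g : ℝ → ℂ, Continuous g ∧ Set.EqOn φ g (Set.Icc ε (1 - ε)) := by
  have h : ContinuousOn φ (Set.Icc ε (1 - ε)) :=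
    hφ.mono fun s hs => ⟨by linarith [hs.1], by linarith [hs.2]⟩
  have hle : ε ≤ 1 - ε := by linarith
  refine ⟨Set.IccExtend hle ((Set.Icc ε (1 - ε)).domRestrict φ), h.domRestrict.Icc_extend',
    fun s hs => ?_⟩
  rw [Set.IccExtend_of_mem _ _ hs, Set.domRestrict_apply]

/-! ### Comparison of the two simplices -/

theorem integral_inv_add_inv_one_sub (hε : 0 < ε) (hε' : ε < 1 / 2) :
    ∫ s in ε..1 - ε, (s⁻¹ + (1 - s)⁻¹) = 2 * Real.log ((1 - ε) / ε) := by
  have h1 : ∫ s in ε..1 - ε, s⁻¹ = Real.log ((1 - ε) / ε) :=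
    integral_inv_of_pos hε (by linarith)
  have h2 : ∫ s in ε..1 - ε, (1 - s)⁻¹ = Real.log ((1 - ε) / ε) := by
    have := intervalIntegral.integral_comp_sub_left (a := ε) (b := 1 - ε) (fun s => s⁻¹) (1 : ℝ)
    rw [this, sub_sub_cancel, h1]
  have hle : ε ≤ 1 - ε := by linarith
  rw [intervalIntegral.integral_add, h1, h2]
  · ring
  · refine ContinuousOn.intervalIntegrable fun s hs => ?_
    rw [Set.uIcc_of_le hle] at hs
    exact (continuousAt_inv₀ (by linarith [hs.1])).continuousWithinAt
  · refine ContinuousOn.intervalIntegrable (ContinuousOn.inv₀ (by fun_prop) fun s hs => ?_)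
    rw [Set.uIcc_of_le hle] at hs
    linarith [hs.2]

/-- The two regions differ by the strip `u - s < ε`. There the inner integral of the bounded
function is at most `M ε`, and the integral of the bound on `φ` grows only like `log(1/ε)`. -/
theorem norm_simplexInt_sub_gapSimplexInt_le (hε : 0 < ε) (hε' : ε ≤ 1 / 3) {φ ψ : ℝ → ℂ}
    (hφ : ContinuousOn φ (Set.Ioo 0 1)) (hψ : ContinuousOn ψ (Set.Ioo 0 1)) {C M : ℝ}
    (hC : ∀ s ∈ Set.Ioo (0 : ℝ) 1, ‖φ s‖ ≤ C * (s⁻¹ + (1 - s)⁻¹))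
    (hM : ∀ s ∈ Set.Ioo (0 : ℝ) 1, ‖ψ s‖ ≤ M) :
    ‖simplexInt φ ψ ε - gapSimplexInt φ ψ ε‖ ≤
      C * M * (2 * (ε * Real.log ((1 - ε) / ε))) := by
  have hIcc : ∀ s ∈ Set.Icc ε (1 - ε), s ∈ Set.Ioo (0 : ℝ) 1 :=
    fun s hs => ⟨by linarith [hs.1], by linarith [hs.2]⟩
  obtain ⟨g, hg, hφg⟩ := exists_continuous_eqOn hε (by linarith) hφ
  obtain ⟨k, hk, hψk⟩ := exists_continuous_eqOn hε (by linarith) hψ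
  rw [simplexInt_congr (by linarith) hφg hψk, gapSimplexInt_congr hε hε' hφg hψk]
  have hi : ∀ x y, IntervalIntegrable k MeasureTheory.volume x y := hk.intervalIntegrable
  set Γ : ℝ → ℂ := fun s => ∫ u in (0 : ℝ)..s, k u with hΓ
  have hΓc : Continuous Γ := intervalIntegral.continuous_primitive hi 0
  have hΓi : ∀ x y, ∫ u in x..y, k u = Γ y - Γ x := fun x y =>
    (intervalIntegral.integral_interval_sub_left (hi _ _) (hi _ _)).symm
  -- The minimum extends the outer integral to `1 - ε`: for `s ≥ 1 - 2ε` the inner integral becomes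
  -- empty.
  have hgap : gapSimplexInt g k ε =
      ∫ s in ε..1 - ε, g s * (Γ (1 - ε) - Γ (min (s + ε) (1 - ε))) := by
    have hc : Continuous fun s => g s * (Γ (1 - ε) - Γ (min (s + ε) (1 - ε))) := by fun_prop
    rw [gapSimplexInt_eq, ← intervalIntegral.integral_add_adjacent_intervals
      (b := 1 - 2 * ε) (hc.intervalIntegrable _ _) (hc.intervalIntegrable _ _)]
    have h0 : ∫ s in 1 - 2 * ε..1 - ε, g s * (Γ (1 - ε) - Γ (min (s + ε) (1 - ε))) = 0 := by
      rw [← intervalIntegral.integral_zero (a := 1 - 2 * ε) (b := 1 - ε)]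
      refine intervalIntegral.integral_congr fun s hs => ?_
      rw [Set.uIcc_of_le (by linarith)] at hs
      simp only [min_eq_right (show 1 - ε ≤ s + ε by linarith [hs.1]), sub_self, mul_zero]
    rw [h0, add_zero]
    refine intervalIntegral.integral_congr fun s hs => ?_
    rw [Set.uIcc_of_le (by linarith)] at hs
    simp only [hΓi, min_eq_left (show s + ε ≤ 1 - ε by linarith [hs.2])]
  have hdiff : simplexInt g k ε - gapSimplexInt g k ε =
      ∫ s in ε..1 - ε, g s * ∫ u in s..min (s + ε) (1 - ε), k u := by
    rw [hgap, simplexInt, ← intervalIntegral.integral_sub]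
    · congr 1
      ext s
      simp only [hΓi]
      ring
    · simp only [hΓi]
      exact Continuous.intervalIntegrable (by fun_prop) _ _
    · exact Continuous.intervalIntegrable (by fun_prop) _ _
  have hM0 : 0 ≤ M := (norm_nonneg _).trans (hM (1 / 2) (by norm_num))
  have hbound : ∀ s ∈ Set.Icc ε (1 - ε), ‖g s * ∫ u in s..min (s + ε) (1 - ε), k u‖ ≤
      C * M * ε * (s⁻¹ + (1 - s)⁻¹) := by
    intro s hs
    have hsm : s ≤ min (s + ε) (1 - ε) := le_min (by linarith) hs.2
    have h1 : ‖∫ u in s..min (s + ε) (1 - ε), k u‖ ≤ M * ε := by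
      refine (intervalIntegral.norm_integral_le_of_norm_le_const (C := M) fun u hu => ?_).trans ?_
      · rw [Set.uIoc_of_le hsm] at hu
        have hu' : u ∈ Set.Icc ε (1 - ε) := ⟨by linarith [hs.1, hu.1], hu.2.trans (min_le_right _ _)⟩
        rw [← hψk hu']
        exact hM u (hIcc u hu')
      · rw [abs_of_nonneg (sub_nonneg.mpr hsm)]
        gcongr
        linarith [min_le_left (s + ε) (1 - ε)]
    rw [norm_mul, ← hφg hs]
    calc ‖φ s‖ * ‖∫ u in s..min (s + ε) (1 - ε), k u‖ ≤ (C * (s⁻¹ + (1 - s)⁻¹)) * (M * ε) :=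
          mul_le_mul (hC s (hIcc s hs)) h1 (norm_nonneg _)
            ((norm_nonneg _).trans (hC s (hIcc s hs)))
      _ = _ := by ring
  rw [hdiff]
  have hle : ε ≤ 1 - ε := by linarith
  refine (intervalIntegral.norm_integral_le_of_norm_le hle (g := fun s =>
    C * M * ε * (s⁻¹ + (1 - s)⁻¹)) (.of_forall fun s hs => hbound s ⟨hs.1.le, hs.2⟩) ?_).trans ?_
  · refine ContinuousOn.intervalIntegrable fun s hs => ContinuousAt.continuousWithinAt ?_
    rw [Set.uIcc_of_le hle] at hs
    have h1 : s ≠ 0 := (hIcc s hs).1.ne'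
    have h2 : 1 - s ≠ 0 := (sub_pos.mpr (hIcc s hs).2).ne'
    fun_prop (disch := assumption)
  · rw [intervalIntegral.integral_const_mul, integral_inv_add_inv_one_sub hε (by linarith)]
    exact le_of_eq (by ring)

theorem tendsto_mul_log_one_sub_div :
    Tendsto (fun ε : ℝ => 2 * (ε * Real.log ((1 - ε) / ε))) (𝓝[>] 0) (𝓝 0) := by
  have h1 : Tendsto (fun ε : ℝ => 2 * (ε * Real.log (1 - ε) - ε * Real.log ε)) (𝓝 0) (𝓝 0) := by
    have h2 : ContinuousAt (fun ε : ℝ => 2 * (ε * Real.log (1 - ε) - ε * Real.log ε)) 0 := by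
      refine continuousAt_const.mul (ContinuousAt.sub (continuousAt_id.mul
        (ContinuousAt.log (by fun_prop) (by norm_num))) Real.continuous_mul_log.continuousAt)
    simpa [ContinuousAt] using h2
  refine (h1.mono_left nhdsWithin_le_nhds).congr' ?_
  filter_upwards [Ioo_mem_nhdsGT (zero_lt_one (α := ℝ))] with ε hε
  rw [Real.log_div (by linarith [hε.2]) hε.1.ne']
  ring

theorem tendsto_simplexInt_sub_gapSimplexInt {φ ψ : ℝ → ℂ}
    (hφ : ContinuousOn φ (Set.Ioo 0 1)) (hψ : ContinuousOn ψ (Set.Ioo 0 1)) {C M : ℝ}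
    (hC : ∀ s ∈ Set.Ioo (0 : ℝ) 1, ‖φ s‖ ≤ C * (s⁻¹ + (1 - s)⁻¹))
    (hM : ∀ s ∈ Set.Ioo (0 : ℝ) 1, ‖ψ s‖ ≤ M) :
    Tendsto (fun ε => simplexInt φ ψ ε - gapSimplexInt φ ψ ε) (𝓝[>] 0) (𝓝 0) := by
  have h := tendsto_mul_log_one_sub_div.const_mul (C * M)
  rw [mul_zero] at h
  refine squeeze_zero_norm' ?_ h
  filter_upwards [Ioo_mem_nhdsGT (show (0 : ℝ) < 1 / 3 by norm_num)] with ε hε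
  exact norm_simplexInt_sub_gapSimplexInt_le hε.1 hε.2.le hφ hψ hC hM

/-! ### The cotangent -/

/-- The addition formula of the cotangent, which plays the role of the Fay identity for the singular
part of `f^(1)`. -/
theorem cotPi_mul_cotPi {s u : ℝ} (hs : 0 < s) (hsu : s < u) (hu : u < 1) :
    cotPi s * cotPi u = cotPi (u - s) * cotPi s - cotPi (u - s) * cotPi u - Real.pi ^ 2 := by
  have h1 := (sin_pi_mul_pos ⟨hs, hsu.trans hu⟩).ne'
  have h2 := (sin_pi_mul_pos ⟨hs.trans hsu, hu⟩).ne'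
  have h3 := (sin_pi_mul_pos (s := u - s) ⟨sub_pos.mpr hsu, by linarith⟩).ne'
  have hD := Real.sin_sub (Real.pi * u) (Real.pi * s)
  have hC := Real.cos_sub (Real.pi * u) (Real.pi * s)
  rw [← mul_sub] at hD hC
  simp only [cotPi]
  generalize Real.sin (Real.pi * (u - s)) = D at *
  generalize Real.cos (Real.pi * (u - s)) = C at *
  field_simp
  linear_combination C * hD - D * hC

theorem abs_cotPi_le {s : ℝ} (hs : s ∈ Set.Ioo (0 : ℝ) 1) :
    |cotPi s| ≤ Real.pi / 2 * (s⁻¹ + (1 - s)⁻¹) := by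
  have hpi := Real.pi_pos
  have h0 : 0 < 1 - s := sub_pos.mpr hs.2
  -- Jordan's inequality `sin x ≥ 2x/π`, applied to `πs` or to `π(1 - s)` according to the half of
  -- the interval.
  have h1 : 2 * (s * (1 - s)) ≤ Real.sin (Real.pi * s) := by
    rcases le_total s (1 / 2) with h | h
    · have h2 := Real.mul_le_sin (x := Real.pi * s) (by have := hs.1; positivity) (by nlinarith)
      rw [show 2 / Real.pi * (Real.pi * s) = 2 * s by field_simp] at h2
      nlinarith [hs.1]
    · have h2 := Real.mul_le_sin (x := Real.pi * (1 - s)) (by positivity) (by nlinarith)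
      rw [show 2 / Real.pi * (Real.pi * (1 - s)) = 2 * (1 - s) by field_simp,
        mul_sub Real.pi, mul_one, Real.sin_pi_sub] at h2
      nlinarith [hs.1]
  have h2 : 0 < s * (1 - s) := mul_pos hs.1 h0
  have h3 : Real.pi / 2 * (s⁻¹ + (1 - s)⁻¹) = Real.pi / (2 * (s * (1 - s))) := by
    have := hs.1.ne'
    have := h0.ne'
    field_simp
    ring
  rw [h3, cotPi, abs_div, abs_mul, abs_of_pos hpi, abs_of_pos (sin_pi_mul_pos hs)]
  gcongr
  exact mul_le_of_le_one_right hpi.le (Real.abs_cos_le_one _)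

/-! ### Behaviour of the integrals as `ε → 0` -/

theorem exists_norm_le_of_continuous {g : ℝ → ℂ} (hg : Continuous g) :
    ∃ M, 0 ≤ M ∧ ∀ s ∈ Set.Ioo (0 : ℝ) 1, ‖g s‖ ≤ M := by
  obtain ⟨M, hM⟩ := (isCompact_Icc (a := (0 : ℝ)) (b := 1)).exists_bound_of_continuousOn
    hg.continuousOn
  exact ⟨M, (norm_nonneg _).trans (hM 0 ⟨le_rfl, zero_le_one⟩),
    fun s hs => hM s (Set.Ioo_subset_Icc_self hs)⟩

theorem one_le_inv_add_inv_one_sub {s : ℝ} (hs : s ∈ Set.Ioo (0 : ℝ) 1) :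
    1 ≤ s⁻¹ + (1 - s)⁻¹ := by
  have h1 : 1 ≤ s⁻¹ := (one_le_inv₀ hs.1).mpr hs.2.le
  have h2 : 0 < (1 - s)⁻¹ := inv_pos.mpr (sub_pos.mpr hs.2)
  linarith

theorem continuous_segmentInt {g : ℝ → ℂ}
    (hg : ∀ a b, IntervalIntegrable g MeasureTheory.volume a b) : Continuous (segmentInt g) := by
  have h : segmentInt g = fun ε => (∫ s in (0 : ℝ)..1 - ε, g s) - ∫ s in (0 : ℝ)..ε, g s := by
    ext ε
    rw [segmentInt, intervalIntegral.integral_interval_sub_left (hg _ _) (hg _ _)]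
  have hc := intervalIntegral.continuous_primitive hg 0
  rw [h]
  exact (hc.comp (continuous_const.sub continuous_id)).sub hc

theorem integral_eq_sub_primitive {g : ℝ → ℂ} (hg : Continuous g) (x y : ℝ) :
    ∫ u in x..y, g u = (∫ u in (0 : ℝ)..y, g u) - ∫ u in (0 : ℝ)..x, g u :=
  (intervalIntegral.integral_interval_sub_left (hg.intervalIntegrable _ _)
    (hg.intervalIntegrable _ _)).symm

theorem continuous_simplexInt {g k : ℝ → ℂ} (hg : Continuous g) (hk : Continuous k) :
    Continuous (simplexInt g k) := by
  set Γ : ℝ → ℂ := fun s => ∫ u in (0 : ℝ)..s, k u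
  have hΓ : Continuous Γ := intervalIntegral.continuous_primitive hk.intervalIntegrable 0
  have h : simplexInt g k = fun ε =>
      segmentInt g ε * Γ (1 - ε) - segmentInt (fun s => g s * Γ s) ε := by
    ext ε
    rw [segmentInt, segmentInt, ← intervalIntegral.integral_mul_const,
      ← intervalIntegral.integral_sub ((hg.fun_mul continuous_const).intervalIntegrable _ _)
      ((hg.fun_mul hΓ).intervalIntegrable _ _), simplexInt]
    congr 1
    ext s
    rw [integral_eq_sub_primitive hk, mul_sub]
  rw [h]
  have h1 := continuous_segmentInt hg.intervalIntegrable
  have h2 := continuous_segmentInt (hg.fun_mul hΓ).intervalIntegrable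
  exact (h1.mul (hΓ.comp (continuous_const.sub continuous_id))).sub h2

theorem simplexInt_add_left (hε : 0 < ε) (hε' : ε ≤ 1 / 2) {φ φ' ψ : ℝ → ℂ}
    (hφ : ContinuousOn φ (Set.Ioo 0 1)) (hφ' : Continuous φ') (hψ : Continuous ψ) :
    simplexInt (fun s => φ s + φ' s) ψ ε = simplexInt φ ψ ε + simplexInt φ' ψ ε := by
  obtain ⟨g, hg, hφg⟩ := exists_continuous_eqOn hε hε' hφ
  have h : Set.EqOn (fun s => φ s + φ' s) (fun s => g s + φ' s) (Set.Icc ε (1 - ε)) :=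
    fun s hs => congr_arg (· + φ' s) (hφg hs)
  rw [simplexInt_congr hε' h (Set.eqOn_refl ψ _), simplexInt_congr hε' hφg (Set.eqOn_refl ψ _)]
  have hΓ : Continuous fun s => ∫ u in s..1 - ε, ψ u := by
    rw [funext fun s => integral_eq_sub_primitive hψ s (1 - ε)]
    exact continuous_const.sub (intervalIntegral.continuous_primitive hψ.intervalIntegrable 0)
  simp only [simplexInt, add_mul]
  exact intervalIntegral.integral_add ((hg.fun_mul hΓ).intervalIntegrable _ _)
    ((hφ'.fun_mul hΓ).intervalIntegrable _ _)

/-- The primitive `log(sin(πs))` of `π cot(πs)`. -/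
noncomputable def logSinPi (s : ℝ) : ℝ := Real.log (Real.sin (Real.pi * s))

theorem hasDerivAt_logSinPi {s : ℝ} (hs : s ∈ Set.Ioo (0 : ℝ) 1) :
    HasDerivAt logSinPi (cotPi s) s := by
  have h := (((hasDerivAt_id s).const_mul Real.pi).sin).log (sin_pi_mul_pos hs).ne'
  refine h.congr_deriv ?_
  rw [cotPi]
  simp only [id_eq]
  ring

theorem intervalIntegrable_logSinPi_mul {g : ℝ → ℂ} (hg : Continuous g) (a b : ℝ) :
    IntervalIntegrable (fun s => g s * (logSinPi s : ℂ)) MeasureTheory.volume a b := by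
  have h1 : IntervalIntegrable logSinPi MeasureTheory.volume a b := by
    have := (intervalIntegrable_log_sin (a := Real.pi * a) (b := Real.pi * b)).comp_mul_left
      (c := Real.pi)
    simp only [Function.comp_def, ne_eq, Real.pi_ne_zero, not_false_eq_true,
      mul_div_cancel_left₀] at this
    exact this
  have h2 : IntervalIntegrable (fun s => (logSinPi s : ℂ)) MeasureTheory.volume a b :=
    ⟨h1.1.ofReal, h1.2.ofReal⟩
  exact h2.continuousOn_mul hg.continuousOn

/-- Integration by parts isolates the divergence in the boundary term at `ε`; the one at `1 - ε`
vanishes because the inner integral is empty. The remaining integral converges since `logSinPi` is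
integrable. -/
theorem simplexInt_cotPi (hε : 0 < ε) (hε' : ε ≤ 1 / 2) {g : ℝ → ℂ} (hg : Continuous g) :
    simplexInt (fun s => (cotPi s : ℂ)) g ε =
      segmentInt (fun s => g s * (logSinPi s : ℂ)) ε - logSinPi ε * segmentInt g ε := by
  have hle : ε ≤ 1 - ε := by linarith
  have hIcc : ∀ s ∈ Set.uIcc ε (1 - ε), s ∈ Set.Ioo (0 : ℝ) 1 := fun s hs => by
    rw [Set.uIcc_of_le hle] at hs
    exact ⟨by linarith [hs.1], by linarith [hs.2]⟩
  have hu : ∀ s ∈ Set.uIcc ε (1 - ε), HasDerivAt (fun s => ∫ u in s..1 - ε, g u) (-g s) s := by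
    intro s _
    exact intervalIntegral.integral_hasDerivAt_left (hg.intervalIntegrable _ _)
      (hg.stronglyMeasurableAtFilter _ _) hg.continuousAt
  have hv : ∀ s ∈ Set.uIcc ε (1 - ε), HasDerivAt (fun s => (logSinPi s : ℂ)) (cotPi s : ℂ) s :=
    fun s hs => (hasDerivAt_logSinPi (hIcc s hs)).ofReal_comp
  have hv' : IntervalIntegrable (fun s => (cotPi s : ℂ)) MeasureTheory.volume ε (1 - ε) :=
    (Complex.continuous_ofReal.comp_continuousOn
      (continuousOn_cotPi.mono hIcc)).intervalIntegrable
  have h := intervalIntegral.integral_mul_deriv_eq_deriv_mul hu hv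
    (hg.neg.intervalIntegrable _ _) hv'
  rw [intervalIntegral.integral_same, zero_mul, zero_sub] at h
  rw [simplexInt, segmentInt, segmentInt]
  simp_rw [mul_comm (cotPi _ : ℂ)]
  rw [h]
  simp only [neg_mul, intervalIntegral.integral_neg]
  ring

/-- Both logarithms are `log t` plus a convergent term. -/
theorem tendsto_log_sub_logSinPi :
    ∃ l : ℂ, Tendsto (fun t : ℝ => Complex.log (-2 * Real.pi * Complex.I * t) - logSinPi t)
      (𝓝[>] 0) (𝓝 l) := by
  have h1 : Tendsto (fun t : ℝ => t⁻¹ * Real.sin (Real.pi * t)) (𝓝[>] 0) (𝓝 Real.pi) := by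
    have h2 : HasDerivAt (fun t => Real.sin (Real.pi * t)) Real.pi 0 := by
      simpa using ((hasDerivAt_id (0 : ℝ)).const_mul Real.pi).sin
    have h3 := (hasDerivAt_iff_tendsto_slope.mp h2).mono_left
      (nhdsWithin_mono 0 (fun s (hs : 0 < s) => hs.ne'))
    refine h3.congr fun t => ?_
    simp [slope_def_module]
  have h4 := ((Real.continuousAt_log Real.pi_ne_zero).tendsto.comp h1).ofReal
  refine ⟨_, (h4.const_sub (Complex.log (-2 * Real.pi * Complex.I))).congr' ?_⟩
  filter_upwards [Ioo_mem_nhdsGT (zero_lt_one (α := ℝ))] with t ht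
  have h5 : (-2 * Real.pi * Complex.I : ℂ) ≠ 0 := by simp [Real.pi_ne_zero]
  rw [mul_comm _ (t : ℂ), Complex.log_ofReal_mul ht.1 h5, Function.comp_apply,
    Real.log_mul (inv_ne_zero ht.1.ne') (sin_pi_mul_pos ht).ne', Real.log_inv, logSinPi]
  push_cast
  ring

theorem tendsto_simplexInt_cotPi {g : ℝ → ℂ} (hg : Continuous g) :
    ∃ l : ℂ, Tendsto (fun t : ℝ => simplexInt (fun s => (cotPi s : ℂ)) g t +
      Complex.log (-2 * Real.pi * Complex.I * t) * segmentInt g t) (𝓝[>] 0) (𝓝 l) := by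
  obtain ⟨l, hl⟩ := tendsto_log_sub_logSinPi
  have h1 := ((continuous_segmentInt (intervalIntegrable_logSinPi_mul hg)).tendsto 0).mono_left
    (nhdsWithin_le_nhds (s := Set.Ioi 0))
  have h2 := ((continuous_segmentInt hg.intervalIntegrable).tendsto 0).mono_left
    (nhdsWithin_le_nhds (s := Set.Ioi 0))
  refine ⟨_, (h1.add (hl.mul h2)).congr' ?_⟩
  filter_upwards [Ioo_mem_nhdsGT (show (0 : ℝ) < 1 / 2 by norm_num)] with t ht
  rw [simplexInt_cotPi ht.1 ht.2.le hg]
  ring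

theorem gapInt_one (ε : ℝ) : gapInt (fun _ _ => 1) ε = ((1 - 3 * ε) ^ 2 / 2 : ℝ) := by
  have h1 : gapInt (fun _ _ => 1) ε = ((∫ s in ε..1 - 2 * ε, (1 - 2 * ε - s) : ℝ) : ℂ) := by
    rw [gapInt, ← intervalIntegral.integral_ofReal]
    congr 1
    ext s
    rw [intervalIntegral.integral_const, Complex.real_smul, mul_one]
    congr 1
    ring
  rw [h1]
  congr 1
  rw [intervalIntegral.integral_comp_sub_left (fun x => x), integral_id]
  ring

/-- Integrating `cotPi_mul_cotPi` and permuting the gaps turns both products on the right into `-J`,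
where `J` is the integral sought. So `3J` is `-π^2` times the area of the region. -/
theorem gapSimplexInt_cotPi (hε : 0 < ε) (hε' : ε ≤ 1 / 3) :
    gapSimplexInt (fun s => (cotPi s : ℂ)) (fun s => (cotPi s : ℂ)) ε =
      -(Real.pi ^ 2 / 3 * ((1 - 3 * ε) ^ 2 / 2) : ℝ) := by
  have hk : ContinuousOn (fun s => (cotPi s : ℂ)) (Set.Ioo 0 1) :=
    Complex.continuous_ofReal.comp_continuousOn continuousOn_cotPi
  obtain ⟨g, hg, hkg⟩ := exists_continuous_eqOn hε (by linarith) hk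
  have hpar : HasParity g (-1) ε := HasParity.congr (fun s _ => by
    rw [cotPi_one_sub]; push_cast; ring) hkg
  rw [gapSimplexInt_congr hε hε' hkg hkg]
  have hc1 : Continuous (Function.uncurry fun s u => g s * g (u - s)) :=
    (hg.comp continuous_fst).mul (hg.comp (continuous_snd.sub continuous_fst))
  have hc2 : Continuous (Function.uncurry fun s u => g u * g (u - s)) :=
    (hg.comp continuous_snd).mul (hg.comp (continuous_snd.sub continuous_fst))
  have h : gapSimplexInt g g ε = gapInt (fun s u => g s * g (u - s) +
      ((-1) * (g u * g (u - s)) + (-(Real.pi ^ 2 : ℝ) : ℂ) * 1)) ε := by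
    refine gapInt_congr hε' fun s u h1 h2 h3 => ?_
    rw [← hkg ⟨h1, by linarith⟩, ← hkg ⟨by linarith, h3⟩, ← hkg ⟨by linarith, by linarith⟩,
      ← Complex.ofReal_mul, cotPi_mul_cotPi (by linarith) (by linarith) (by linarith)]
    push_cast
    ring
  rw [gapInt_add hc1 (by fun_prop), gapInt_add (by fun_prop) (by fun_prop), gapInt_const_mul,
    gapInt_const_mul, gapInt_mul_comp_sub_left hε hε' g hpar, gapInt_mul_comp_sub_right hε' hg hg,
    gapInt_one] at h
  push_cast at h ⊢
  linear_combination (1 / 3 : ℂ) * h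

namespace IsFaySystem

variable {φ : ℕ → ℝ → ℂ}

/-! ### Integrals of a Fay system -/

theorem continuousOn (hφ : IsFaySystem φ) (k : ℕ) : ContinuousOn (φ k) (Set.Ioo 0 1) := by
  by_cases hk : k = 1
  · obtain ⟨h, hh, he⟩ := hφ.singular
    rw [hk]
    exact ((Complex.continuous_ofReal.comp_continuousOn continuousOn_cotPi).add
      hh.continuousOn).congr he
  · obtain ⟨g, hg, he⟩ := hφ.regular k hk
    exact hg.continuousOn.congr he

theorem hasParity (hφ : IsFaySystem φ) (hε : 0 < ε) (k : ℕ) : HasParity (φ k) ((-1) ^ k) ε :=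
  hasParity_of_Ioo hε (hφ.reflect k)

theorem segmentInt_eq (hφ : IsFaySystem φ) (hε : 0 < ε) (hε' : ε ≤ 1 / 2) (k : ℕ) :
    segmentInt (φ k) ε = (-1) ^ k * segmentInt (φ k) ε :=
  (hφ.hasParity hε k).segmentInt_eq hε'

theorem segmentInt_one (hφ : IsFaySystem φ) (hε : 0 < ε) (hε' : ε ≤ 1 / 2) :
    segmentInt (φ 1) ε = 0 := by
  have h := hφ.segmentInt_eq hε hε' 1
  rw [pow_one, neg_one_mul] at h
  exact self_eq_neg.mp h

theorem simplexInt_reflect (hφ : IsFaySystem φ) (hε : 0 < ε) (hε' : ε ≤ 1 / 2) (m n : ℕ) :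
    simplexInt (φ m) (φ n) ε = (-1) ^ (m + n) * simplexInt (φ n) (φ m) ε := by
  obtain ⟨g, hg, hm⟩ := exists_continuous_eqOn hε hε' (hφ.continuousOn m)
  obtain ⟨k, hk, hn⟩ := exists_continuous_eqOn hε hε' (hφ.continuousOn n)
  rw [simplexInt_congr hε' hm hn, simplexInt_congr hε' hn hm, pow_add]
  exact EllipticMZV.simplexInt_reflect hε' hg hk ((hφ.hasParity hε m).congr hm)
    ((hφ.hasParity hε n).congr hn)

theorem gapSimplexInt_reflect (hφ : IsFaySystem φ) (hε : 0 < ε) (hε' : ε ≤ 1 / 3) (m n : ℕ) :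
    gapSimplexInt (φ m) (φ n) ε = (-1) ^ (m + n) * gapSimplexInt (φ n) (φ m) ε := by
  obtain ⟨g, hg, hm⟩ := exists_continuous_eqOn hε (by linarith) (hφ.continuousOn m)
  obtain ⟨k, hk, hn⟩ := exists_continuous_eqOn hε (by linarith) (hφ.continuousOn n)
  rw [gapSimplexInt_congr hε hε' hm hn, gapSimplexInt_congr hε hε' hn hm, pow_add]
  exact EllipticMZV.gapSimplexInt_reflect hε hε' hg hk ((hφ.hasParity hε m).congr hm)
    ((hφ.hasParity hε n).congr hn)

theorem simplexInt_shuffle (hφ : IsFaySystem φ) (hε : 0 < ε) (hε' : ε ≤ 1 / 2) (m n : ℕ) :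
    simplexInt (φ m) (φ n) ε + simplexInt (φ n) (φ m) ε =
      segmentInt (φ m) ε * segmentInt (φ n) ε := by
  obtain ⟨g, hg, hm⟩ := exists_continuous_eqOn hε hε' (hφ.continuousOn m)
  obtain ⟨k, hk, hn⟩ := exists_continuous_eqOn hε hε' (hφ.continuousOn n)
  rw [simplexInt_congr hε' hm hn, simplexInt_congr hε' hn hm, segmentInt_congr hε' hm,
    segmentInt_congr hε' hn]
  exact EllipticMZV.simplexInt_shuffle hε' hg hk

/-- The Fay relation for the integrals over the symmetric simplex. -/
theorem gapSimplexInt_fay (hφ : IsFaySystem φ) (hε : 0 < ε) (hε' : ε ≤ 1 / 3) (m n : ℕ) :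
    gapSimplexInt (φ m) (φ n) ε = -((-1) ^ n * gapSimplexInt (φ 0) (φ (m + n)) ε) +
      ∑ r ∈ Finset.range (n + 1), (-1) ^ (n - r) * (m.multichoose r : ℂ) *
        gapSimplexInt (φ (m + r)) (φ (n - r)) ε +
      ∑ r ∈ Finset.range (m + 1), (-1) ^ (n + r) * (n.multichoose r : ℂ) *
        gapSimplexInt (φ (n + r)) (φ (m - r)) ε := by
  have hg : ∀ k, ∃ g : ℝ → ℂ, Continuous g ∧ Set.EqOn (φ k) g (Set.Icc ε (1 - ε)) := fun k =>
    exists_continuous_eqOn hε (by linarith) (hφ.continuousOn k)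
  choose g hg hφg using hg
  have hpar : ∀ k, HasParity (g k) ((-1) ^ k) ε := fun k => (hφ.hasParity hε k).congr (hφg k)
  have hJ : ∀ i j, gapSimplexInt (φ i) (φ j) ε = gapSimplexInt (g i) (g j) ε := fun i j =>
    gapSimplexInt_congr hε hε' (hφg i) (hφg j)
  have hc1 : ∀ i j, Continuous (Function.uncurry fun s u => g i s * g j (u - s)) := fun i j =>
    ((hg i).comp continuous_fst).mul ((hg j).comp (continuous_snd.sub continuous_fst))
  have hc2 : ∀ i j, Continuous (Function.uncurry fun s u => g i u * g j (u - s)) := fun i j =>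
    ((hg i).comp continuous_snd).mul ((hg j).comp (continuous_snd.sub continuous_fst))
  have hK1 : Continuous (Function.uncurry fun s u => (-(-1) ^ m : ℂ) * (g 0 s * g (m + n) (u - s))) :=
    continuous_const.mul (hc1 _ _)
  have hK2 : ∀ r, Continuous (Function.uncurry fun s u =>
      (m.multichoose r : ℂ) * (g (m + r) s * g (n - r) (u - s))) :=
    fun r => continuous_const.mul (hc1 _ _)
  have hK3 : ∀ r, Continuous (Function.uncurry fun s u =>
      ((n.multichoose r : ℂ) * (-1) ^ (m - r)) * (g (n + r) u * g (m - r) (u - s))) :=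
    fun r => continuous_const.mul (hc2 _ _)
  have hS2 : Continuous (Function.uncurry fun s u => ∑ r ∈ Finset.range (n + 1),
      (m.multichoose r : ℂ) * (g (m + r) s * g (n - r) (u - s))) :=
    continuous_finsetSum _ fun r _ => hK2 r
  have hS3 : Continuous (Function.uncurry fun s u => ∑ r ∈ Finset.range (m + 1),
      ((n.multichoose r : ℂ) * (-1) ^ (m - r)) * (g (n + r) u * g (m - r) (u - s))) :=
    continuous_finsetSum _ fun r _ => hK3 r
  -- The factor `g 0 s = 1` is inserted so that every summand is a product to which an exchange of
  -- gaps applies.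
  have h : gapSimplexInt (φ m) (φ n) ε = gapInt (fun s u =>
      (-(-1) ^ m : ℂ) * (g 0 s * g (m + n) (u - s)) +
      ((∑ r ∈ Finset.range (n + 1), (m.multichoose r : ℂ) * (g (m + r) s * g (n - r) (u - s))) +
      ∑ r ∈ Finset.range (m + 1),
        ((n.multichoose r : ℂ) * (-1) ^ (m - r)) * (g (n + r) u * g (m - r) (u - s)))) ε := by
    refine gapInt_congr hε' fun s u h1 h2 h3 => ?_
    have hs : s ∈ Set.Icc ε (1 - ε) := ⟨h1, by linarith⟩
    have hu : u ∈ Set.Icc ε (1 - ε) := ⟨by linarith, h3⟩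
    have hus : u - s ∈ Set.Icc ε (1 - ε) := ⟨by linarith, by linarith⟩
    simp only [← hφg _ hs, ← hφg _ hu, ← hφg _ hus]
    rw [hφ.fay m n s u (by linarith) (by linarith) (by linarith),
      hφ.zero s ⟨by linarith, by linarith⟩, add_assoc, one_mul, neg_mul]
    simp only [mul_assoc, mul_left_comm (φ _ u)]
  rw [h, gapInt_add hK1 (by exact hS2.add hS3), gapInt_add hS2 hS3, gapInt_sum _ hK2, gapInt_sum _ hK3,
    ← add_assoc]
  simp only [gapInt_const_mul, gapInt_mul_comp_sub_left hε hε' _ (hpar _),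
    gapInt_mul_comp_sub_right hε' (hg _) (hg _), ← hJ]
  have hsq : ∀ k : ℕ, ((-1 : ℂ) ^ k) ^ 2 = 1 := fun k => by rw [← pow_mul, pow_mul']; simp
  congr 1
  · congr 1
    · rw [pow_add]
      linear_combination (-(-1) ^ n * gapSimplexInt (φ 0) (φ (m + n)) ε) * hsq m
    · exact Finset.sum_congr rfl fun r _ => by ring
  · refine Finset.sum_congr rfl fun r hr => ?_
    have hr' : r ≤ m := Nat.lt_succ_iff.mp (Finset.mem_range.mp hr)
    -- The exchange of the first two gaps leaves the functions in the order `m - r`, `n + r`;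
    -- reflection restores the order in the statement and supplies the remaining sign.
    rw [hφ.gapSimplexInt_reflect hε hε' (m - r) (n + r)]
    rw [pow_add (-1 : ℂ) (m - r) (n + r)]
    linear_combination ((n.multichoose r : ℂ) * (-1) ^ (n + r) *
      gapSimplexInt (φ (n + r)) (φ (m - r)) ε) * hsq (m - r)

/-! ### Limits -/

theorem exists_norm_le (hφ : IsFaySystem φ) {k : ℕ} (hk : k ≠ 1) :
    ∃ M, 0 ≤ M ∧ ∀ s ∈ Set.Ioo (0 : ℝ) 1, ‖φ k s‖ ≤ M := by
  obtain ⟨g, hg, he⟩ := hφ.regular k hk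
  obtain ⟨M, hM0, hM⟩ := exists_norm_le_of_continuous hg
  exact ⟨M, hM0, fun s hs => by rw [he hs]; exact hM s hs⟩

theorem exists_norm_le_mul (hφ : IsFaySystem φ) (k : ℕ) :
    ∃ C, ∀ s ∈ Set.Ioo (0 : ℝ) 1, ‖φ k s‖ ≤ C * (s⁻¹ + (1 - s)⁻¹) := by
  by_cases hk : k = 1
  · obtain ⟨h, hh, he⟩ := hφ.singular
    obtain ⟨M, hM0, hM⟩ := exists_norm_le_of_continuous hh
    refine ⟨Real.pi / 2 + M, fun s hs => ?_⟩
    rw [hk, he s hs, add_mul]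
    refine (norm_add_le _ _).trans (add_le_add ?_ ?_)
    · rw [Complex.norm_real]
      exact abs_cotPi_le hs
    · exact (hM s hs).trans (le_mul_of_one_le_right hM0 (one_le_inv_add_inv_one_sub hs))
  · obtain ⟨M, hM0, hM⟩ := hφ.exists_norm_le hk
    exact ⟨M, fun s hs => (hM s hs).trans
      (le_mul_of_one_le_right hM0 (one_le_inv_add_inv_one_sub hs))⟩

theorem eventually_small {c : ℝ} (hc : 0 < c) : ∀ᶠ ε : ℝ in 𝓝[>] 0, 0 < ε ∧ ε ≤ c := by
  filter_upwards [Ioo_mem_nhdsGT hc] with ε hε using ⟨hε.1, hε.2.le⟩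

theorem tendsto_sub_of_ne (hφ : IsFaySystem φ) {m n : ℕ} (h : m ≠ 1 ∨ n ≠ 1) :
    Tendsto (fun ε => simplexInt (φ m) (φ n) ε - gapSimplexInt (φ m) (φ n) ε) (𝓝[>] 0) (𝓝 0) := by
  have key : ∀ i j, j ≠ 1 → Tendsto
      (fun ε => simplexInt (φ i) (φ j) ε - gapSimplexInt (φ i) (φ j) ε) (𝓝[>] 0) (𝓝 0) := by
    intro i j hj
    obtain ⟨C, hC⟩ := hφ.exists_norm_le_mul i
    obtain ⟨M, _, hM⟩ := hφ.exists_norm_le hj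
    exact tendsto_simplexInt_sub_gapSimplexInt (hφ.continuousOn i) (hφ.continuousOn j) hC hM
  rcases h with h | h
  -- If only the first function is known to be bounded, reflection makes it the second one.
  · have h1 := (key n m h).const_mul ((-1) ^ (m + n))
    rw [mul_zero] at h1
    refine h1.congr' ?_
    filter_upwards [eventually_small (show (0 : ℝ) < 1 / 3 by norm_num)] with ε hε
    rw [hφ.simplexInt_reflect hε.1 (by linarith [hε.2]) m n,
      hφ.gapSimplexInt_reflect hε.1 hε.2 m n, mul_sub]
  · exact key m n h

/-- By shuffle, twice this integral is the square of the integral of an odd function. -/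
theorem simplexInt_one_one (hφ : IsFaySystem φ) (hε : 0 < ε) (hε' : ε ≤ 1 / 2) :
    simplexInt (φ 1) (φ 1) ε = 0 := by
  have h := hφ.simplexInt_shuffle hε hε' 1 1
  rw [hφ.segmentInt_one hε hε', zero_mul] at h
  exact add_self_eq_zero.mp h

end IsFaySystem

/-- Integrals over the two simplices of two odd functions, one of which is bounded. -/
theorem tendsto_gapSimplexInt_of_odd {φ ψ : ℝ → ℂ}
    (hφ : ContinuousOn φ (Set.Ioo 0 1)) (hψ : ContinuousOn ψ (Set.Ioo 0 1)) {C M : ℝ}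
    (hC : ∀ s ∈ Set.Ioo (0 : ℝ) 1, ‖φ s‖ ≤ C * (s⁻¹ + (1 - s)⁻¹))
    (hM : ∀ s ∈ Set.Ioo (0 : ℝ) 1, ‖ψ s‖ ≤ M)
    (hφ' : ∀ s ∈ Set.Ioo (0 : ℝ) 1, φ (1 - s) = -1 * φ s)
    (hψ' : ∀ s ∈ Set.Ioo (0 : ℝ) 1, ψ (1 - s) = -1 * ψ s) :
    Tendsto (gapSimplexInt φ ψ) (𝓝[>] 0) (𝓝 0) := by
  have h := (tendsto_simplexInt_sub_gapSimplexInt hφ hψ hC hM).neg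
  rw [neg_zero] at h
  refine h.congr' ?_
  filter_upwards [IsFaySystem.eventually_small (show (0 : ℝ) < 1 / 3 by norm_num)] with ε hε
  have h2 : ε ≤ 1 / 2 := by linarith [hε.2]
  obtain ⟨g, hg, hφg⟩ := exists_continuous_eqOn hε.1 h2 hφ
  obtain ⟨k, hk, hψk⟩ := exists_continuous_eqOn hε.1 h2 hψ
  have hgp := (hasParity_of_Ioo hε.1 hφ').congr hφg
  have hkp := (hasParity_of_Ioo hε.1 hψ').congr hψk
  -- Shuffle and reflection force the integral over the ordinary simplex to vanish, so the other one
  -- is minus the difference of the two.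
  have h0 : segmentInt g ε = 0 := self_eq_neg.mp (by simpa using hgp.segmentInt_eq h2)
  have h1 := simplexInt_shuffle h2 hg hk
  rw [simplexInt_reflect h2 hk hg hkp hgp, h0, zero_mul, neg_mul_neg, one_mul, one_mul] at h1
  rw [simplexInt_congr h2 hφg hψk, add_self_eq_zero.mp h1, zero_sub, neg_neg]

namespace IsFaySystem

variable {φ : ℕ → ℝ → ℂ}

/-- In the expansion of `φ 1 = cotPi + h` the mixed terms and the `h`-term tend to 0 by oddness; the
cotangent term gives `-π^2/6`. -/
theorem tendsto_gapSimplexInt_one_one (hφ : IsFaySystem φ) :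
    Tendsto (gapSimplexInt (φ 1) (φ 1)) (𝓝[>] 0) (𝓝 (-riemannZeta 2)) := by
  obtain ⟨h, hh, he⟩ := hφ.singular
  obtain ⟨M, hM0, hM⟩ := exists_norm_le_of_continuous hh
  have hk : ContinuousOn (fun s => (cotPi s : ℂ)) (Set.Ioo 0 1) :=
    Complex.continuous_ofReal.comp_continuousOn continuousOn_cotPi
  have hkC : ∀ s ∈ Set.Ioo (0 : ℝ) 1, ‖(cotPi s : ℂ)‖ ≤ Real.pi / 2 * (s⁻¹ + (1 - s)⁻¹) :=
    fun s hs => by rw [Complex.norm_real]; exact abs_cotPi_le hs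
  have hMC : ∀ s ∈ Set.Ioo (0 : ℝ) 1, ‖h s‖ ≤ M * (s⁻¹ + (1 - s)⁻¹) := fun s hs =>
    (hM s hs).trans (le_mul_of_one_le_right hM0 (one_le_inv_add_inv_one_sub hs))
  have hkp : ∀ s ∈ Set.Ioo (0 : ℝ) 1, (cotPi (1 - s) : ℂ) = -1 * cotPi s := fun s _ => by
    rw [cotPi_one_sub]; push_cast; ring
  have hhp : ∀ s ∈ Set.Ioo (0 : ℝ) 1, h (1 - s) = -1 * h s := fun s hs => by
    have h1 := hφ.reflect 1 s hs
    rw [he s hs, he (1 - s) ⟨sub_pos.mpr hs.2, by linarith [hs.1]⟩, hkp s hs] at h1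
    linear_combination h1
  have hkh := tendsto_gapSimplexInt_of_odd hk hh.continuousOn hkC hM hkp hhp
  have hhh := tendsto_gapSimplexInt_of_odd hh.continuousOn hh.continuousOn hMC hM hhp hhp
  have hkk : Tendsto (fun ε : ℝ => (-(Real.pi ^ 2 / 3 * ((1 - 3 * ε) ^ 2 / 2) : ℝ) : ℂ)) (𝓝[>] 0)
      (𝓝 (-riemannZeta 2)) := by
    have hc : Continuous fun ε : ℝ => (-(Real.pi ^ 2 / 3 * ((1 - 3 * ε) ^ 2 / 2) : ℝ) : ℂ) := by
      fun_prop
    have h0 := (hc.tendsto 0).mono_left (nhdsWithin_le_nhds (s := Set.Ioi 0))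
    convert h0 using 2
    rw [riemannZeta_two]
    push_cast
    ring
  have hsum := hkk.add ((hkh.add hkh).add hhh)
  simp only [add_zero] at hsum
  refine hsum.congr' ?_
  filter_upwards [eventually_small (show (0 : ℝ) < 1 / 3 by norm_num)] with ε hε
  obtain ⟨g, hg, hkg⟩ := exists_continuous_eqOn hε.1 (by linarith [hε.2]) hk
  have hIcc : ∀ s ∈ Set.Icc ε (1 - ε), s ∈ Set.Ioo (0 : ℝ) 1 := fun s hs =>
    ⟨by linarith [hs.1, hε.1], by linarith [hs.2, hε.1]⟩
  have hEq : Set.EqOn (φ 1) (fun s => g s + h s) (Set.Icc ε (1 - ε)) := fun s hs => by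
    rw [he s (hIcc s hs)]
    exact congr_arg (· + h s) (hkg hs)
  have hgp : HasParity g (-1) ε := (hasParity_of_Ioo hε.1 hkp).congr hkg
  have hhp' : HasParity h (-1) ε := hasParity_of_Ioo hε.1 hhp
  rw [← gapSimplexInt_cotPi hε.1 hε.2, gapSimplexInt_congr hε.1 hε.2 hkg hkg,
    gapSimplexInt_congr hε.1 hε.2 hkg (Set.eqOn_refl h _), gapSimplexInt_congr hε.1 hε.2 hEq hEq]
  have hx : gapSimplexInt (fun s => g s + h s) (fun s => g s + h s) ε =
      gapInt (fun s u => g s * g u + ((g s * h u + h s * g u) + h s * h u)) ε := by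
    refine gapInt_congr hε.2 fun s u _ _ _ => ?_
    ring
  rw [hx, gapInt_add (continuous_uncurry_mul hg hg) (by fun_prop),
    gapInt_add (by fun_prop) (continuous_uncurry_mul hh hh),
    gapInt_add (continuous_uncurry_mul hg hh) (continuous_uncurry_mul hh hg)]
  have hsym : gapSimplexInt h g ε = gapSimplexInt g h ε := by
    rw [EllipticMZV.gapSimplexInt_reflect hε.1 hε.2 hh hg hhp' hgp]
    ring
  change _ = gapSimplexInt g g ε + (gapSimplexInt g h ε + gapSimplexInt h g ε +
    gapSimplexInt h h ε)
  rw [hsym]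

/-- The only source of `ζ(2)`: the limits over the two truncated simplices differ exactly when both
forms have a pole. -/
theorem tendsto_simplexInt_sub (hφ : IsFaySystem φ) (m n : ℕ) :
    Tendsto (fun ε => simplexInt (φ m) (φ n) ε - gapSimplexInt (φ m) (φ n) ε) (𝓝[>] 0)
      (𝓝 (if m = 1 then if n = 1 then riemannZeta 2 else 0 else 0)) := by
  by_cases hm : m = 1
  · by_cases hn : n = 1
    · rw [if_pos hm, if_pos hn, hm, hn]
      have h := hφ.tendsto_gapSimplexInt_one_one.neg
      rw [neg_neg] at h
      refine h.congr' ?_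
      filter_upwards [eventually_small (show (0 : ℝ) < 1 / 2 by norm_num)] with ε hε
      rw [hφ.simplexInt_one_one hε.1 hε.2, zero_sub]
    · rw [if_pos hm, if_neg hn]
      exact hφ.tendsto_sub_of_ne (.inr hn)
  · rw [if_neg hm]
    exact hφ.tendsto_sub_of_ne (.inl hm)

end IsFaySystem

/-! ### The regularized series in length one and two -/

theorem regSeries_singleton (τ : ℂ) (t : ℝ) (m : ℕ) :
    regSeries τ t [m] = segmentInt (fun s => f τ m s) t := by
  by_cases hm : m = 1 <;>
    simp [regSeries, WordSeries.mul, Finset.sum_range_succ, expAd, pathSeries, iterInt, segmentInt,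
      hm]

/-- The conjugation contributes a commutator term linear in the logarithm. For `m = n = 1` the
quadratic terms `1/2 - 1 + 1/2` cancel. -/
theorem regSeries_pair (τ : ℂ) (t : ℝ) (m n : ℕ) :
    regSeries τ t [m, n] = simplexInt (fun s => f τ m s) (fun s => f τ n s) t +
      Complex.log (-2 * Real.pi * Complex.I * t) *
        ((if m = 1 then segmentInt (fun s => f τ n s) t else 0) -
          if n = 1 then segmentInt (fun s => f τ m s) t else 0) := by
  by_cases hm : m = 1 <;> by_cases hn : n = 1 <;>
    simp [regSeries, WordSeries.mul, Finset.sum_range_succ, expAd, pathSeries, iterInt, segmentInt,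
      simplexInt, hm, hn, List.replicate] <;> ring

/-! ### Combinatorics of the Fay relation -/

/-- Only `r = 0` contributes: the other possibility `m = 0`, `r = 1` has coefficient `multichoose 0
1 = 0`. -/
theorem sum_multichoose_left (m n : ℕ) (X : ℕ → ℂ) :
    ∑ r ∈ Finset.range (n + 1), (-1) ^ (n - r) * (m.multichoose r : ℂ) *
      (if m + r = 1 then X (n - r) else 0) = if m = 1 then (-1) ^ n * X n else 0 := by
  rw [Finset.sum_range_succ', Finset.sum_eq_zero fun r _ => ?_]
  · simp
  · rcases m with _ | m
    · simp
    · rw [if_neg (by omega), mul_zero]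

theorem sum_multichoose_right (m n : ℕ) (Y : ℕ → ℂ) :
    ∑ r ∈ Finset.range (n + 1), (-1) ^ (n - r) * (m.multichoose r : ℂ) *
      (if n - r = 1 then Y (m + r) else 0) =
    if n = 0 then 0 else -((m.multichoose (n - 1) : ℂ) * Y (m + (n - 1))) := by
  rcases n with _ | n
  · simp
  · rw [Finset.sum_eq_single n]
    · simp
    · intro r hr hrn
      have := Finset.mem_range.mp hr
      rw [if_neg (by omega), mul_zero]
    · intro h
      exact absurd (Finset.mem_range.mpr (by omega)) h

/-- The linear combination on the right hand side of the Fay relation. -/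
def fayCombination (G : ℕ → ℕ → ℂ) (m n : ℕ) : ℂ :=
  -((-1) ^ n * G 0 (m + n)) +
    ∑ r ∈ Finset.range (n + 1), (-1) ^ (n - r) * (m.multichoose r : ℂ) * G (m + r) (n - r) +
    ∑ r ∈ Finset.range (m + 1), (-1) ^ (n + r) * (n.multichoose r : ℂ) * G (n + r) (m - r)

theorem sum_neg_one_pow_swap (G : ℕ → ℕ → ℂ) (m n : ℕ) :
    ∑ r ∈ Finset.range (m + 1), (-1) ^ (n + r) * (n.multichoose r : ℂ) * G (n + r) (m - r) =
    (-1) ^ (m + n) *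
      ∑ r ∈ Finset.range (m + 1), (-1) ^ (m - r) * (n.multichoose r : ℂ) * G (n + r) (m - r) := by
  rw [Finset.mul_sum]
  refine Finset.sum_congr rfl fun r hr => ?_
  have hr' : r ≤ m := Nat.lt_succ_iff.mp (Finset.mem_range.mp hr)
  have h : (-1 : ℂ) ^ (m + n) * (-1) ^ (m - r) = (-1) ^ (n + r) := by
    rw [← pow_add, show m + n + (m - r) = (n + r) + 2 * (m - r) by omega, pow_add, pow_mul]
    simp
  rw [← h]
  ring

theorem fayCombination_add (G H : ℕ → ℕ → ℂ) (m n : ℕ) :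
    fayCombination (fun i j => G i j + H i j) m n = fayCombination G m n + fayCombination H m n := by
  simp only [fayCombination, mul_add, Finset.sum_add_distrib]
  ring

theorem fayCombination_const_mul (c : ℂ) (G : ℕ → ℕ → ℂ) (m n : ℕ) :
    fayCombination (fun i j => c * G i j) m n = c * fayCombination G m n := by
  simp only [fayCombination, mul_left_comm _ c, ← Finset.mul_sum]
  ring

/-- The Fay relation for the correction terms of the regularization. -/
theorem fayCombination_correction (P : ℕ → ℂ) (hP : ∀ k, P k = (-1) ^ k * P k) (m n : ℕ) :
    fayCombination (fun i j => (if i = 1 then P j else 0) - if j = 1 then P i else 0) m n =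
      (if m = 1 then P n else 0) - if n = 1 then P m else 0 := by
  have hodd : ∀ k, (-1) ^ (k + 1) * P k = -P k := fun k => by
    rw [pow_succ]; linear_combination hP k
  simp only [fayCombination]
  rw [sum_neg_one_pow_swap (fun i j => (if i = 1 then P j else 0) - if j = 1 then P i else 0)]
  simp only [mul_sub, Finset.sum_sub_distrib, sum_multichoose_left, sum_multichoose_right]
  rcases m with _ | m
  · rcases n with _ | _ | n
    · simp
    · simp
    · simp
  · rcases n with _ | n
    · rcases m with _ | m
      · simp
      · simp
    -- Each of the two sums leaves a term in `P (m + n + 1)`. Their binomial coefficients agree, and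
    -- the parity of `P` makes their signs opposite.
    · have hs : (m + 1).multichoose n = (n + 1).multichoose m := by
        rw [Nat.multichoose_eq, Nat.multichoose_eq, show m + 1 + n - 1 = m + n by omega,
          show n + 1 + m - 1 = n + m by omega, add_comm n m, Nat.choose_symm_add]
      have h0 := hodd (m + 1 + n)
      have h1 : (if m + 1 = 1 then (-1) ^ (n + 1) * P (n + 1) else 0) =
          if m + 1 = 1 then P (n + 1) else 0 := by rw [← hP]
      have h2 : (-1) ^ (m + 1 + (n + 1)) * (if n + 1 = 1 then (-1) ^ (m + 1) * P (m + 1) else 0) =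
          -if n + 1 = 1 then P (m + 1) else 0 := by
        split_ifs with h
        · rw [← hP, h, hodd]
        · simp
      simp only [Nat.add_eq_zero_iff, one_ne_zero, and_false, if_false, Nat.add_sub_cancel,
        show m + 1 + (n + 1) ≠ 1 by omega, zero_ne_one]
      rw [h1, h2, hs, show n + 1 + m = m + 1 + n by omega]
      linear_combination ((n + 1).multichoose m : ℂ) * h0

/-- Each of the two sums contributes `-z` when `m = n = 1`, through its `r = 0` term. -/
theorem fayCombination_zeta (z : ℂ) (m n : ℕ) :
    fayCombination (fun i j => if i = 1 then if j = 1 then z else 0 else 0) m n =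
      -(2 * if m = 1 ∧ n = 1 then z else 0) := by
  simp only [fayCombination]
  rw [sum_neg_one_pow_swap (fun i j => if i = 1 then if j = 1 then z else 0 else 0),
    sum_multichoose_left m n (fun j => if j = 1 then z else 0),
    sum_multichoose_left n m (fun j => if j = 1 then z else 0)]
  by_cases hm : m = 1 <;> by_cases hn : n = 1 <;> simp [hm, hn]
  ring

theorem tendsto_fayCombination {ι : Type*} {l : Filter ι} {G : ι → ℕ → ℕ → ℂ} {L : ℕ → ℕ → ℂ}
    (h : ∀ i j, Tendsto (fun x => G x i j) l (𝓝 (L i j))) (m n : ℕ) :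
    Tendsto (fun x => fayCombination (G x) m n) l (𝓝 (fayCombination L m n)) := by
  unfold fayCombination
  refine ((((h _ _).const_mul _).neg).add ?_).add ?_
  · exact tendsto_finsetSum _ fun r _ => (h _ _).const_mul _
  · exact tendsto_finsetSum _ fun r _ => (h _ _).const_mul _

/-! ### Existence of the limits and relations -/

theorem exists_tendsto_regSeries_singleton (hτ : 0 < τ.im) (m : ℕ) :
    ∃ l, Tendsto (fun t : ℝ => regSeries τ t [m]) (𝓝[>] 0) (𝓝 l) := by
  have hφ := isFaySystem_f hτ
  simp only [regSeries_singleton]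
  by_cases hm : m = 1
  · refine ⟨0, tendsto_const_nhds.congr' ?_⟩
    filter_upwards [IsFaySystem.eventually_small (show (0 : ℝ) < 1 / 2 by norm_num)] with t ht
    rw [hm]
    exact (hφ.segmentInt_one ht.1 ht.2).symm
  · obtain ⟨g, hg, he⟩ := hφ.regular m hm
    refine ⟨_, (((continuous_segmentInt hg.intervalIntegrable).tendsto 0).mono_left
      nhdsWithin_le_nhds).congr' ?_⟩
    filter_upwards [IsFaySystem.eventually_small (show (0 : ℝ) < 1 / 2 by norm_num)] with t ht
    exact segmentInt_congr ht.2 fun s hs =>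
      (he ⟨by linarith [hs.1, ht.1], by linarith [hs.2, ht.1]⟩).symm

theorem regSeries_reflect (hτ : 0 < τ.im) {t : ℝ} (ht : 0 < t) (ht' : t ≤ 1 / 2) (m n : ℕ) :
    regSeries τ t [m, n] = (-1) ^ (m + n) * regSeries τ t [n, m] := by
  have hφ := isFaySystem_f hτ
  rw [regSeries_pair, regSeries_pair]
  have h1 := hφ.simplexInt_reflect ht ht' m n
  have hm := hφ.segmentInt_eq ht ht' m
  have hn := hφ.segmentInt_eq ht ht' n
  rw [h1]
  by_cases h2 : m = 1 <;> by_cases h3 : n = 1 <;> simp only [h2, h3, if_true, if_false] at hm hn ⊢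
  · ring
  · rw [pow_add]
    linear_combination Complex.log (-2 * Real.pi * Complex.I * t) * hn
  · rw [pow_add]
    linear_combination -Complex.log (-2 * Real.pi * Complex.I * t) * hm
  · ring

theorem regSeries_shuffle (hτ : 0 < τ.im) {t : ℝ} (ht : 0 < t) (ht' : t ≤ 1 / 2) (m n : ℕ) :
    regSeries τ t [m, n] + regSeries τ t [n, m] = regSeries τ t [m] * regSeries τ t [n] := by
  rw [regSeries_pair, regSeries_pair, regSeries_singleton, regSeries_singleton,
    ← (isFaySystem_f hτ).simplexInt_shuffle ht ht' m n]
  ring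

theorem exists_tendsto_regSeries_pair_of_ne (hτ : 0 < τ.im) (m : ℕ) {n : ℕ} (hn : n ≠ 1) :
    ∃ l, Tendsto (fun t : ℝ => regSeries τ t [m, n]) (𝓝[>] 0) (𝓝 l) := by
  have hφ := isFaySystem_f hτ
  simp only [regSeries_pair, if_neg hn, sub_zero]
  obtain ⟨g, hg, hge⟩ := hφ.regular n hn
  have hIoo : ∀ {t s : ℝ}, 0 < t → s ∈ Set.Icc t (1 - t) → s ∈ Set.Ioo (0 : ℝ) 1 :=
    fun ht hs => ⟨by linarith [hs.1], by linarith [hs.2]⟩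
  by_cases hm : m = 1
  · obtain ⟨h, hh, he⟩ := hφ.singular
    obtain ⟨l, hl⟩ := tendsto_simplexInt_cotPi hg
    have h1 := ((continuous_simplexInt hh hg).tendsto 0).mono_left
      (nhdsWithin_le_nhds (s := Set.Ioi 0))
    refine ⟨_, (hl.add h1).congr' ?_⟩
    filter_upwards [IsFaySystem.eventually_small (show (0 : ℝ) < 1 / 2 by norm_num)] with t ht
    -- The cotangent part of `f^(1)` is paired with the logarithmic correction, and the product of
    -- the two continuous parts converges without it.
    rw [if_pos hm, hm, simplexInt_congr (φ' := fun s => cotPi s + h s) (ψ' := g) ht.2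
      (fun s hs => he s (hIoo ht.1 hs)) (fun s hs => hge (hIoo ht.1 hs)),
      simplexInt_add_left (φ := fun s => (cotPi s : ℂ)) ht.1 ht.2
        (Complex.continuous_ofReal.comp_continuousOn continuousOn_cotPi) hh hg,
      segmentInt_congr ht.2 (fun s hs => hge (hIoo ht.1 hs))]
    ring
  · obtain ⟨k, hk, hke⟩ := hφ.regular m hm
    refine ⟨_, (((continuous_simplexInt hk hg).tendsto 0).mono_left nhdsWithin_le_nhds).congr' ?_⟩
    filter_upwards [IsFaySystem.eventually_small (show (0 : ℝ) < 1 / 2 by norm_num)] with t ht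
    rw [if_neg hm, mul_zero, add_zero]
    exact simplexInt_congr ht.2 (fun s hs => (hke (hIoo ht.1 hs)).symm)
      (fun s hs => (hge (hIoo ht.1 hs)).symm)

theorem exists_tendsto_regSeries_pair (hτ : 0 < τ.im) (m n : ℕ) :
    ∃ l, Tendsto (fun t : ℝ => regSeries τ t [m, n]) (𝓝[>] 0) (𝓝 l) := by
  by_cases hn : n = 1
  · by_cases hm : m = 1
    · have hφ := isFaySystem_f hτ
      refine ⟨0, tendsto_const_nhds.congr' ?_⟩
      filter_upwards [IsFaySystem.eventually_small (show (0 : ℝ) < 1 / 2 by norm_num)] with t ht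
      rw [hm, hn, regSeries_pair, hφ.simplexInt_one_one ht.1 ht.2]
      ring
    · obtain ⟨l, hl⟩ := exists_tendsto_regSeries_pair_of_ne hτ n hm
      refine ⟨_, (hl.const_mul ((-1) ^ (m + n))).congr' ?_⟩
      filter_upwards [IsFaySystem.eventually_small (show (0 : ℝ) < 1 / 2 by norm_num)] with t ht
      exact (regSeries_reflect hτ ht.1 ht.2 m n).symm
  · exact exists_tendsto_regSeries_pair_of_ne hτ m hn

theorem tendsto_IA_singleton (hτ : 0 < τ.im) (m : ℕ) :
    Tendsto (fun t : ℝ => regSeries τ t [m]) (𝓝[>] 0) (𝓝 (IA τ [m])) :=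
  tendsto_nhds_limUnder (exists_tendsto_regSeries_singleton hτ m)

theorem tendsto_IA_pair (hτ : 0 < τ.im) (m n : ℕ) :
    Tendsto (fun t : ℝ => regSeries τ t [m, n]) (𝓝[>] 0) (𝓝 (IA τ [m, n])) :=
  tendsto_nhds_limUnder (exists_tendsto_regSeries_pair hτ m n)

/-- Let `z` be `ζ(2)` at `(1, 1)` and 0 elsewhere. The differences `IA - z` are the limits of the
regularized integrals over the symmetric simplex, so they are reproduced by `fayCombination`. Since
`fayCombination` sends `z` to `-2z`, it follows that `IA = fayCombination IA + 3z`. -/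
theorem IA_fay (hτ : 0 < τ.im) (m n : ℕ) :
    IA τ [m, n] = (if m = 1 ∧ n = 1 then 3 * riemannZeta 2 else 0) +
      fayCombination (fun i j => IA τ [i, j]) m n := by
  have hφ := isFaySystem_f hτ
  set z : ℕ → ℕ → ℂ := fun i j => if i = 1 then if j = 1 then riemannZeta 2 else 0 else 0 with hz
  -- The regularized coefficient with `gapSimplexInt` in place of `simplexInt`; for it the Fay
  -- relation is exact at every small `t`.
  set R : ℝ → ℕ → ℕ → ℂ := fun t i j => regSeries τ t [i, j] +
    -1 * (simplexInt (fun s => f τ i s) (fun s => f τ j s) t -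
      gapSimplexInt (fun s => f τ i s) (fun s => f τ j s) t) with hR
  have hlim : ∀ i j, Tendsto (fun t => R t i j) (𝓝[>] 0) (𝓝 (IA τ [i, j] + -1 * z i j)) :=
    fun i j => (tendsto_IA_pair hτ i j).add ((hφ.tendsto_simplexInt_sub i j).const_mul (-1))
  have hfay : (fun t => fayCombination (R t) m n) =ᶠ[𝓝[>] 0] fun t => R t m n := by
    filter_upwards [IsFaySystem.eventually_small (show (0 : ℝ) < 1 / 3 by norm_num)] with t ht
    have hR' : ∀ i j, R t i j = gapSimplexInt (fun s => f τ i s) (fun s => f τ j s) t +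
        Complex.log (-2 * Real.pi * Complex.I * t) *
        ((if i = 1 then segmentInt (fun s => f τ j s) t else 0) -
          if j = 1 then segmentInt (fun s => f τ i s) t else 0) := fun i j => by
      simp only [hR, regSeries_pair]
      ring
    have h1 := fayCombination_correction (fun k => segmentInt (fun s => f τ k s) t)
      (fun k => hφ.segmentInt_eq ht.1 (by linarith [ht.2]) k) m n
    have h2 := hφ.gapSimplexInt_fay ht.1 ht.2 m n
    rw [hR' m n, funext fun i => funext fun j => hR' i j, fayCombination_add,
      fayCombination_const_mul, h1, h2]
    rfl
  have h := tendsto_nhds_unique ((tendsto_fayCombination hlim m n).congr' hfay) (hlim m n)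
  rw [fayCombination_add, fayCombination_const_mul, fayCombination_zeta] at h
  by_cases hmn : m = 1 ∧ n = 1
  · simp only [hmn, z, if_true, and_self] at h ⊢
    linear_combination -h
  · have hz0 : z m n = 0 := by
      simp only [hz]
      split_ifs with h1 h2
      · exact absurd ⟨h1, h2⟩ hmn
      · rfl
      · rfl
    rw [if_neg hmn, hz0] at h
    rw [if_neg hmn]
    linear_combination -h

end EllipticMZV

theorem mainTheorem9 (τ : ℂ) (hτ : 0 < τ.im) :
    -- the limits that define the values of length one and two exist
    (∀ m : ℕ, Tendsto (fun t : ℝ => EllipticMZV.regSeries τ t [m]) (𝓝[>] 0)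
      (𝓝 (EllipticMZV.IA τ [m]))) ∧
    (∀ m n : ℕ, Tendsto (fun t : ℝ => EllipticMZV.regSeries τ t [m, n]) (𝓝[>] 0)
      (𝓝 (EllipticMZV.IA τ [m, n]))) ∧
    -- reflection relation
    (∀ m n : ℕ, EllipticMZV.IA τ [m, n] = (-1) ^ (m + n) * EllipticMZV.IA τ [n, m]) ∧
    -- shuffle relation
    (∀ m n : ℕ, EllipticMZV.IA τ [m, n] + EllipticMZV.IA τ [n, m] =
      EllipticMZV.IA τ [m] * EllipticMZV.IA τ [n]) ∧
    -- Fay relation; `Nat.multichoose m r` is the binomial coefficient `(m - 1 + r choose r)`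
    (∀ m n : ℕ, EllipticMZV.IA τ [m, n] =
      (if m = 1 ∧ n = 1 then 3 * riemannZeta 2 else 0)
      - (-1) ^ n * EllipticMZV.IA τ [0, m + n]
      + ∑ r ∈ Finset.range (n + 1),
          (-1) ^ (n - r) * (Nat.multichoose m r : ℂ) * EllipticMZV.IA τ [m + r, n - r]
      + ∑ r ∈ Finset.range (m + 1),
          (-1) ^ (n + r) * (Nat.multichoose n r : ℂ) * EllipticMZV.IA τ [n + r, m - r]) := by

  have small := EllipticMZV.IsFaySystem.eventually_small (show (0 : ℝ) < 1 / 2 by norm_num)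
  refine ⟨EllipticMZV.tendsto_IA_singleton hτ, EllipticMZV.tendsto_IA_pair hτ, fun m n => ?_,
    fun m n => ?_, fun m n => ?_⟩
  · refine tendsto_nhds_unique (EllipticMZV.tendsto_IA_pair hτ m n)
      (((EllipticMZV.tendsto_IA_pair hτ n m).const_mul ((-1) ^ (m + n))).congr' ?_)
    filter_upwards [small] with t ht
    exact (EllipticMZV.regSeries_reflect hτ ht.1 ht.2 m n).symm
  · refine tendsto_nhds_unique
      ((EllipticMZV.tendsto_IA_pair hτ m n).add (EllipticMZV.tendsto_IA_pair hτ n m))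
      (((EllipticMZV.tendsto_IA_singleton hτ m).mul
        (EllipticMZV.tendsto_IA_singleton hτ n)).congr' ?_)
    filter_upwards [small] with t ht
    exact (EllipticMZV.regSeries_shuffle hτ ht.1 ht.2 m n).symm
  · rw [EllipticMZV.IA_fay hτ m n, EllipticMZV.fayCombination]
    ring
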